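/- Let $N\ge 2$ and let $\lambda,s\in C^1([0,\infty),\mathbb R)$ be nondecreasing functions with finite limits $\lambda_\infty,s_\infty$ at infinity, such that $s>0$ on $[0,\infty)$ and $\lambda_\infty<1/s_\infty$. Write $g(r,z)=-\lambda(r)z+\frac{z}{s(r)+z^2}$, $g_\infty(z)=-\lambda_\infty z+\frac{z}{s_\infty+z^2}$, $G(r,z)=\int_0^z g(r,t)\,dt$ and $G_\infty(z)=\int_0^z g_\infty(t)\,dt$. For $\alpha\in\mathbb R$ call a pair $(\alpha_*,\alpha^*)$ of positive numbers admissible for $\alpha$ if $\alpha\in[-\alpha_*,\alpha^*]$, if there are constants $\kappa,K>0$ with $\kappa z^2\le g_\infty(z)z\le g(r,z)z\le Kz^2$ for all $r\ge 0$ and $z\in[-\alpha_*,\alpha^*]$, and if $G(0,\alpha)\le\min\{G_\infty(-\alpha_*),G_\infty(\alpha^*)\}$. Then there are an open interval $I\subseteq\mathbb R$ containing $0$ and a continuum $\mathcal C=\{u_\alpha\in C^2(\mathbb R^N):\alpha\in I\}$ in $C^2(\mathbb R^N)$, that is, a connected subset with respect to uniform convergence on $\mathbb R^N$ of the zeroth,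 first and second derivatives, consisting of radially symmetric classical solutions of $$-\Delta u+\lambda(|x|)u=\frac{u}{s(|x|)+u^2}\quad\text{in }\mathbb R^N ,$$ such that for every $\alpha\in I$, with $u_\alpha(x)=u_\alpha(|x|)$ (and the profile extended evenly to $\mathbb R$): 1. $u_\alpha(0)=\alpha$, $u_\alpha$ is oscillating (it has an unbounded sequence of zeros) and localized ($u_\alpha(x)\to0$ as $|x|\to\infty$); 2. admissible pairs for $\alpha$ exist, and $\|u_\alpha\|_{L^\infty}\le\min\{\alpha_*,\alpha^*\}$ for every pair $(\alpha_*,\alpha^*)$ admissible for $\alpha$; moreover $\|u_\alpha'\|_{L^\infty}\le\sqrt{2G(0,\alpha)}$; 3. there is $C>0$, which may depend on $\alpha$, with $|u_\alpha(r)|+|u_\alpha'(r)|+|u_\alpha''(r)|\le C\,r^{(1-N)/2}$ for all $r\ge1$; and, if $\alpha\ne0$, there is $c>0$, which may depend on $\alpha$, with $c\,r^{(1-N)/2}\le|u_\alpha(r)|+|u_\alpha'(r)|+|u_\alpha''(r)|$ for all $r\ge1$. If $\lambda_\infty\le0$, then $I=\mathbb R$. -/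

import Mathlib

open Set Filter Topology

noncomputable section

namespace SaturableHelmholtz

/-- The space `C²(ℝ^N)` of twice continuously differentiable real functions. -/
def C2Space (N : ℕ) : Type :=
  {u : EuclideanSpace ℝ (Fin N) → ℝ // ContDiff ℝ 2 u}

instance (N : ℕ) : CoeFun (C2Space N) (fun _ => EuclideanSpace ℝ (Fin N) → ℝ) :=
  ⟨fun u => u.1⟩

/-- `C²(ℝ^N)` carries the topology of uniform convergence, on the whole of `ℝ^N`, of the
zeroth, first and second derivatives. -/
instance (N : ℕ) : TopologicalSpace (C2Space N) :=
  TopologicalSpace.induced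
    (fun u : C2Space N =>
      (UniformFun.ofFun u.1, UniformFun.ofFun (fderiv ℝ u.1),
        UniformFun.ofFun (fderiv ℝ (fderiv ℝ u.1))))
    inferInstance

/-- A function is oscillating if it has an unbounded sequence of zeros. -/
def IsOscillating {N : ℕ} (u : EuclideanSpace ℝ (Fin N) → ℝ) : Prop :=
  ∃ x : ℕ → EuclideanSpace ℝ (Fin N),
    Tendsto (fun n => ‖x n‖) atTop atTop ∧ ∀ n, u (x n) = 0

/-- A function is localized if it converges to zero at infinity. -/
def IsLocalized {N : ℕ} (u : EuclideanSpace ℝ (Fin N) → ℝ) : Prop :=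
  Tendsto u (cocompact (EuclideanSpace ℝ (Fin N))) (𝓝 0)

/-- Classical solutions of `-Δu + lam(|x|) u = u / (s(|x|) + u²)` in `ℝ^N`
(used for `u` of class `C²`). -/
def IsClassicalSolution {N : ℕ} (lam s : ℝ → ℝ) (u : EuclideanSpace ℝ (Fin N) → ℝ) : Prop :=
  ∀ x, -(Laplacian.laplacian u x) + lam ‖x‖ * u x = u x / (s ‖x‖ + u x ^ 2)

/-- The saturable nonlinearity `z ↦ -l z + z / (σ + z²)`. With `l = lam r`, `σ = s r` this is
`g(r, z)`; with the limits of `lam` and `s` it is `g_∞(z)`. -/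
def satNonlin (l σ z : ℝ) : ℝ := -l * z + z / (σ + z ^ 2)

/-- The primitive of the saturable nonlinearity vanishing at `0`: `G(r, z)` and `G_∞(z)`. -/
def satPrim (l σ z : ℝ) : ℝ := ∫ t in (0 : ℝ)..z, satNonlin l σ t

/-- The pair `a = α_*`, `b = α^*` of positive numbers is admissible for the initial value `α`:
`α ∈ [-a, b]`, there are constants `0 < κ`, `0 < K` with
`κ z² ≤ g_∞(z) z ≤ g(r, z) z ≤ K z²` on `[0, ∞) × [-a, b]`, and
`G(0, α) ≤ min {G_∞(-a), G_∞(b)}`. -/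
def IsAdmissible (lam s : ℝ → ℝ) (lamInf sInf α a b : ℝ) : Prop :=
  0 < a ∧ 0 < b ∧ α ∈ Icc (-a) b ∧
  (∃ κ K : ℝ, 0 < κ ∧ 0 < K ∧ ∀ r : ℝ, 0 ≤ r → ∀ z ∈ Icc (-a) b,
    κ * z ^ 2 ≤ satNonlin lamInf sInf z * z ∧
    satNonlin lamInf sInf z * z ≤ satNonlin (lam r) (s r) z * z ∧
    satNonlin (lam r) (s r) z * z ≤ K * z ^ 2) ∧
  satPrim (lam 0) (s 0) α ≤ min (satPrim lamInf sInf (-a)) (satPrim lamInf sInf b)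

end SaturableHelmholtz

end

/-! Put `n = N - 1`. A radial solution satisfies `u'' + (n / r) u' + g(r, u) = 0`. Since `g` is
globally Lipschitz in `u`, Picard iteration in a space weighted by `exp (K r²)` solves this problem
on all of `ℝ` for every initial value, with Lipschitz dependence on `α` (`exists_isRadialProfile`).
The quotient `q = u' / r` is carried along with `u`; it extends continuously to the origin and makes
the lift to `ℝ^N` of class `C²`.

The energy `u'² / 2 + G(r, u)` decreases: the term `u' / r` acts as friction, and `G` decreases in
`r` because `lam` and `s` increase. If `G(0, α) ≤ G_∞(M)` with `g_∞(z) z > 0` for `0 < |z| ≤ M`, the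
profile cannot cross the height `M` (`Confines.abs_le`), and on that range the energy is comparable
to `P = u² + u'²`. The interval `I` consists of the `α` for which such an `M` exists with strict
inequalities.

For the decay rate, `F = rⁿ (energy + (n / 2) u u' / r)` is comparable to `rⁿ P` for large `r`. Its
derivative is at most `F` times a multiple of `P / r + lam' + s' + 1 / r²`. The last three terms are
integrable because `lam` and `s` have limits. The first is integrable because `energy + (1 / 2) u u'
/ r` is nonnegative and loses at least a multiple of `P / r`. A two-sided Gronwall estimate then
bounds `F` above and below by multiples of its value at a fixed radius (`exists_comparable`), and
that value is positive when `α ≠ 0` by backward uniqueness.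

Oscillation follows from the angle `arctan (u' / u)`, which decreases at a rate bounded away from
zero while `u` does not vanish. The family is continuous in `C²` because at a large radius the
energy is small for all nearby `α`, hence small from there on, while on bounded sets the Lipschitz
dependence applies. The continuum is the continuous image of `I`. -/

namespace SaturableHelmholtz

/-! ### Part: the saturable nonlinearity, its primitive, and confining heights. -/

theorem satNonlin_mul_self (l σ z : ℝ) :
    satNonlin l σ z * z = (1 / (σ + z ^ 2) - l) * z ^ 2 := by
  unfold satNonlin; ring

theorem satNonlin_zero (l σ : ℝ) : satNonlin l σ 0 = 0 := by simp [satNonlin]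

theorem abs_div_sub_div_le {σ : ℝ} (hσ : 0 < σ) (z y : ℝ) :
    |z / (σ + z ^ 2) - y / (σ + y ^ 2)| ≤ 1 / σ * |z - y| := by
  have hz : 0 < σ + z ^ 2 := by positivity
  have hy : 0 < σ + y ^ 2 := by positivity
  have : z / (σ + z ^ 2) - y / (σ + y ^ 2) =
      (σ - z * y) / ((σ + z ^ 2) * (σ + y ^ 2)) * (z - y) := by field_simp; ring
  rw [this, abs_mul]
  gcongr
  rw [abs_div, abs_of_pos (mul_pos hz hy), div_le_div_iff₀ (mul_pos hz hy) hσ, ← abs_of_pos hσ,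
    ← abs_mul, abs_of_pos hσ, one_mul, abs_le]
  constructor <;> nlinarith [mul_nonneg hσ.le (sq_nonneg (z - y)), mul_nonneg hσ.le (sq_nonneg (z + y)),
    mul_nonneg (sq_nonneg z) (sq_nonneg y), mul_nonneg hσ.le (sq_nonneg z),
    mul_nonneg hσ.le (sq_nonneg y), sq_nonneg σ]

theorem hasDerivAt_closedPrim {l σ : ℝ} (hσ : 0 < σ) (z : ℝ) :
    HasDerivAt (fun z => -l * z ^ 2 / 2 + Real.log (1 + z ^ 2 / σ) / 2) (satNonlin l σ z) z := by
  have h1 : HasDerivAt (fun z : ℝ => 1 + z ^ 2 / σ) (2 * z / σ) z := by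
    simpa using ((hasDerivAt_pow 2 z).div_const σ).const_add 1
  have h2 : HasDerivAt (fun z : ℝ => -l * z ^ 2 / 2) (-l * (2 * z) / 2) z := by
    simpa using ((hasDerivAt_pow 2 z).const_mul (-l)).div_const 2
  refine (h2.add ((h1.log (by positivity)).div_const 2)).congr_deriv ?_
  unfold satNonlin
  have : 0 < σ + z ^ 2 := by positivity
  field_simp

theorem continuous_satNonlin {l σ : ℝ} (hσ : 0 < σ) : Continuous (satNonlin l σ) := by
  unfold satNonlin
  exact (by fun_prop : Continuous fun z : ℝ => -l * z).add
    (continuous_id.div (by fun_prop) fun z => by positivity)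

theorem satPrim_eq {l σ : ℝ} (hσ : 0 < σ) (z : ℝ) :
    satPrim l σ z = -l * z ^ 2 / 2 + Real.log (1 + z ^ 2 / σ) / 2 := by
  unfold satPrim
  rw [intervalIntegral.integral_eq_sub_of_hasDerivAt (fun x _ => hasDerivAt_closedPrim hσ x)
    ((continuous_satNonlin hσ).intervalIntegrable _ _)]
  simp

theorem hasDerivAt_satPrim {l σ : ℝ} (hσ : 0 < σ) (z : ℝ) :
    HasDerivAt (satPrim l σ) (satNonlin l σ z) z := by
  rw [show satPrim l σ = _ from funext (satPrim_eq hσ)]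
  exact hasDerivAt_closedPrim hσ z

theorem satPrim_neg {l σ : ℝ} (hσ : 0 < σ) (z : ℝ) : satPrim l σ (-z) = satPrim l σ z := by
  simp [satPrim_eq hσ]

theorem satPrim_abs {l σ : ℝ} (hσ : 0 < σ) (z : ℝ) : satPrim l σ |z| = satPrim l σ z := by
  simp [satPrim_eq hσ]

theorem satPrim_zero (l σ : ℝ) : satPrim l σ 0 = 0 := by simp [satPrim]

theorem satPrim_le_satPrim {l l' σ σ' : ℝ} (hl : l ≤ l') (hσ : 0 < σ) (hσ' : σ ≤ σ') (z : ℝ) :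
    satPrim l' σ' z ≤ satPrim l σ z := by
  rw [satPrim_eq hσ, satPrim_eq (hσ.trans_le hσ')]
  have h1 : -l' * z ^ 2 / 2 ≤ -l * z ^ 2 / 2 := by nlinarith [sq_nonneg z]
  have h2 : Real.log (1 + z ^ 2 / σ') ≤ Real.log (1 + z ^ 2 / σ) := by
    apply Real.log_le_log (by have := hσ.trans_le hσ'; positivity); gcongr
  linarith

theorem satPrim_le {l σ : ℝ} (hσ : 0 < σ) (z : ℝ) :
    satPrim l σ z ≤ (1 / σ - l) * z ^ 2 / 2 := by
  rw [satPrim_eq hσ]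
  have := Real.log_le_sub_one_of_pos (show 0 < 1 + z ^ 2 / σ by positivity)
  have h : 1 / σ * z ^ 2 = z ^ 2 / σ := by ring
  linarith

theorem le_log_one_add_div {σ : ℝ} (hσ : 0 < σ) (z : ℝ) :
    1 / (σ + z ^ 2) * z ^ 2 ≤ Real.log (1 + z ^ 2 / σ) := by
  have := Real.one_sub_inv_le_log_of_pos (show 0 < 1 + z ^ 2 / σ by positivity)
  refine le_trans (le_of_eq ?_) this
  have : 0 < σ + z ^ 2 := by positivity
  field_simp
  ring

/-- The primitive dominates half of `g(z) z`. -/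
theorem half_satNonlin_mul_le_satPrim {l σ : ℝ} (hσ : 0 < σ) (z : ℝ) :
    satNonlin l σ z * z / 2 ≤ satPrim l σ z := by
  rw [satPrim_eq hσ, satNonlin_mul_self]
  linarith [le_log_one_add_div hσ z]

/-- The quadratic parts of `G` and `g z / 2` cancel, leaving a quartic remainder. The additional
factor `z²` is what makes this term integrable in the decay estimate. -/
theorem satPrim_sub_half_le {l σ : ℝ} (hσ : 0 < σ) (z : ℝ) :
    satPrim l σ z - satNonlin l σ z * z / 2 ≤ z ^ 4 / (2 * σ ^ 2) := by
  rw [satPrim_eq hσ, satNonlin_mul_self]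
  have := Real.log_le_sub_one_of_pos (show 0 < 1 + z ^ 2 / σ by positivity)
  have h : z ^ 2 / σ - 1 / (σ + z ^ 2) * z ^ 2 ≤ z ^ 4 / σ ^ 2 := by
    have h0 : 0 < σ + z ^ 2 := by positivity
    have : z ^ 2 / σ - 1 / (σ + z ^ 2) * z ^ 2 = z ^ 4 / (σ * (σ + z ^ 2)) := by
      field_simp; ring
    rw [this]
    gcongr
    nlinarith [sq_nonneg z]
  have h2 : z ^ 4 / (2 * σ ^ 2) = z ^ 4 / σ ^ 2 / 2 := by field_simp
  rw [h2]; linarith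

/-- The derivative factors as `z (1 - l (σ + z²)) / (σ + z²)`, and its sign on `(0, M)` is decided
by the inequality at the endpoint `M`; for `l ≤ 0` that inequality is automatic. -/
theorem satPrim_strictMonoOn {l σ M : ℝ} (hσ : 0 < σ) (hM : l * (σ + M ^ 2) < 1) :
    StrictMonoOn (satPrim l σ) (Icc 0 M) := by
  apply strictMonoOn_of_deriv_pos (convex_Icc _ _)
  · exact fun z _ => (hasDerivAt_satPrim hσ z).continuousAt.continuousWithinAt
  · intro z hz
    rw [interior_Icc] at hz
    rw [(hasDerivAt_satPrim hσ z).deriv]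
    have h0 : 0 < σ + z ^ 2 := by positivity
    have h1 : l * (σ + z ^ 2) < 1 := by
      rcases le_or_gt l 0 with h | h
      · nlinarith
      · have : z ^ 2 < M ^ 2 := by nlinarith [hz.1, hz.2]
        nlinarith
    have : satNonlin l σ z = z * (1 - l * (σ + z ^ 2)) / (σ + z ^ 2) := by
      unfold satNonlin; field_simp; ring
    rw [this]
    exact div_pos (mul_pos hz.1 (by linarith)) h0

/-- Standing assumptions on the coefficients of the saturable Helmholtz equation. -/
structure Coefficients (lam s : ℝ → ℝ) (lamInf sInf : ℝ) : Prop where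
  contDiffOn_lam : ContDiffOn ℝ 1 lam (Ici 0)
  contDiffOn_s : ContDiffOn ℝ 1 s (Ici 0)
  monotoneOn_lam : MonotoneOn lam (Ici 0)
  monotoneOn_s : MonotoneOn s (Ici 0)
  tendsto_lam : Tendsto lam atTop (𝓝 lamInf)
  tendsto_s : Tendsto s atTop (𝓝 sInf)
  s_pos : ∀ r : ℝ, 0 ≤ r → 0 < s r
  lamInf_lt : lamInf < 1 / sInf

theorem le_of_monotoneOn_of_tendsto {f : ℝ → ℝ} {L : ℝ} (hf : MonotoneOn f (Ici 0))
    (h : Tendsto f atTop (𝓝 L)) {r : ℝ} (hr : 0 ≤ r) : f r ≤ L :=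
  ge_of_tendsto h <| (eventually_ge_atTop r).mono fun _ hx => hf hr (hr.trans hx) hx

/-- An upper bound for the Lipschitz constants of the nonlinearities. -/
noncomputable def lipBound (lam s : ℝ → ℝ) (lamInf : ℝ) : ℝ := |lam 0| + |lamInf| + 1 / s 0

namespace Coefficients

variable {lam s : ℝ → ℝ} {lamInf sInf : ℝ}

theorem lam_le (h : Coefficients lam s lamInf sInf) {r : ℝ} (hr : 0 ≤ r) : lam r ≤ lamInf :=
  le_of_monotoneOn_of_tendsto h.monotoneOn_lam h.tendsto_lam hr

theorem s_le (h : Coefficients lam s lamInf sInf) {r : ℝ} (hr : 0 ≤ r) : s r ≤ sInf :=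
  le_of_monotoneOn_of_tendsto h.monotoneOn_s h.tendsto_s hr

theorem le_lam (h : Coefficients lam s lamInf sInf) {r : ℝ} (hr : 0 ≤ r) : lam 0 ≤ lam r :=
  h.monotoneOn_lam (mem_Ici.2 le_rfl) hr hr

theorem le_s (h : Coefficients lam s lamInf sInf) {r : ℝ} (hr : 0 ≤ r) : s 0 ≤ s r :=
  h.monotoneOn_s (mem_Ici.2 le_rfl) hr hr

theorem s_zero_pos (h : Coefficients lam s lamInf sInf) : 0 < s 0 := h.s_pos 0 le_rfl

theorem sInf_pos (h : Coefficients lam s lamInf sInf) : 0 < sInf :=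
  h.s_zero_pos.trans_le (h.s_le le_rfl)

theorem abs_lam_le (h : Coefficients lam s lamInf sInf) {r : ℝ} (hr : 0 ≤ r) :
    |lam r| ≤ |lam 0| + |lamInf| := by
  have h1 := h.le_lam hr
  have h2 := h.lam_le hr
  rw [abs_le]
  constructor
  · linarith [neg_abs_le (lam 0), abs_nonneg lamInf]
  · linarith [le_abs_self lamInf, abs_nonneg (lam 0)]

theorem lipBound_pos (h : Coefficients lam s lamInf sInf) : 0 < lipBound lam s lamInf := by
  have := h.s_zero_pos
  unfold lipBound; positivity

theorem one_div_s_sub_lam_le (h : Coefficients lam s lamInf sInf) {r : ℝ} (hr : 0 ≤ r) :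
    1 / s r - lam r ≤ lipBound lam s lamInf := by
  have h1 : 1 / s r ≤ 1 / s 0 := one_div_le_one_div_of_le h.s_zero_pos (h.le_s hr)
  have := neg_abs_le (lam r)
  have := h.abs_lam_le hr
  unfold lipBound
  linarith

theorem abs_satNonlin_sub_le (h : Coefficients lam s lamInf sInf) {r : ℝ} (hr : 0 ≤ r)
    (z y : ℝ) :
    |satNonlin (lam r) (s r) z - satNonlin (lam r) (s r) y| ≤ lipBound lam s lamInf * |z - y| := by
  have h1 : 1 / s r ≤ 1 / s 0 := one_div_le_one_div_of_le h.s_zero_pos (h.le_s hr)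
  have h2 := h.abs_lam_le hr
  have h3 := abs_div_sub_div_le (h.s_pos r hr) z y
  calc |satNonlin (lam r) (s r) z - satNonlin (lam r) (s r) y|
      = |-lam r * (z - y) + (z / (s r + z ^ 2) - y / (s r + y ^ 2))| := by
        unfold satNonlin; ring_nf
    _ ≤ |lam r| * |z - y| + 1 / s 0 * |z - y| := by
        refine (abs_add_le _ _).trans ?_
        rw [abs_mul, abs_neg]
        have : 1 / s r * |z - y| ≤ 1 / s 0 * |z - y| := by gcongr
        linarith
    _ ≤ _ := by
        unfold lipBound
        nlinarith [abs_nonneg (z - y)]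

theorem abs_satNonlin_le (h : Coefficients lam s lamInf sInf) {r : ℝ} (hr : 0 ≤ r) (z : ℝ) :
    |satNonlin (lam r) (s r) z| ≤ lipBound lam s lamInf * |z| := by
  simpa [satNonlin_zero] using h.abs_satNonlin_sub_le hr z 0

/-- The coefficients are controlled only on `[0, ∞)`; composing with `|·|` yields even continuous
functions on `ℝ`, so that the radial equation can be posed on the whole line. -/
theorem continuous_comp_abs {f : ℝ → ℝ} (hf : ContinuousOn f (Ici 0)) :
    Continuous fun r : ℝ => f |r| :=
  hf.comp_continuous continuous_abs fun r => abs_nonneg r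

theorem continuous_satNonlin_abs (h : Coefficients lam s lamInf sInf) :
    Continuous fun p : ℝ × ℝ => satNonlin (lam |p.1|) (s |p.1|) p.2 := by
  have h1 := (continuous_comp_abs h.contDiffOn_lam.continuousOn).comp
    (continuous_fst (X := ℝ) (Y := ℝ))
  have h2 := (continuous_comp_abs h.contDiffOn_s.continuousOn).comp
    (continuous_fst (X := ℝ) (Y := ℝ))
  unfold satNonlin
  refine (h1.neg.mul continuous_snd).add (continuous_snd.div (h2.add (continuous_snd.pow 2)) ?_)
  intro p
  have := h.s_pos |p.1| (abs_nonneg _)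
  exact (by positivity : 0 < s |p.1| + p.2 ^ 2).ne'

theorem satPrim_inf_le (h : Coefficients lam s lamInf sInf) {r : ℝ} (hr : 0 ≤ r) (z : ℝ) :
    satPrim lamInf sInf z ≤ satPrim (lam r) (s r) z :=
  satPrim_le_satPrim (h.lam_le hr) (h.s_pos r hr) (h.s_le hr) z

theorem satNonlin_inf_mul_le (h : Coefficients lam s lamInf sInf) {r : ℝ} (hr : 0 ≤ r) (z : ℝ) :
    satNonlin lamInf sInf z * z ≤ satNonlin (lam r) (s r) z * z := by
  rw [satNonlin_mul_self, satNonlin_mul_self]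
  have := h.s_pos r hr
  have h1 : 1 / (sInf + z ^ 2) ≤ 1 / (s r + z ^ 2) := by
    gcongr; exact h.s_le hr
  have := h.lam_le hr
  gcongr

theorem satNonlin_mul_le (h : Coefficients lam s lamInf sInf) {r : ℝ} (hr : 0 ≤ r) (z : ℝ) :
    satNonlin (lam r) (s r) z * z ≤ lipBound lam s lamInf * z ^ 2 := by
  have h1 := le_abs_self (satNonlin (lam r) (s r) z * z)
  rw [abs_mul] at h1
  have h2 := mul_le_mul_of_nonneg_right (h.abs_satNonlin_le hr z) (abs_nonneg z)
  rw [mul_assoc, abs_mul_abs_self] at h2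
  rw [sq]; linarith

theorem le_satNonlin_inf_mul (h : Coefficients lam s lamInf sInf) {M z : ℝ}
    (hz : |z| ≤ M) :
    (1 / (sInf + M ^ 2) - lamInf) * z ^ 2 ≤ satNonlin lamInf sInf z * z := by
  rw [satNonlin_mul_self]
  have := h.sInf_pos
  have h1 : z ^ 2 ≤ M ^ 2 := by rw [← sq_abs z]; gcongr
  gcongr

end Coefficients

/-- The height `M` confines solutions starting at `α`. -/
structure Confines (lam s : ℝ → ℝ) (lamInf sInf α M : ℝ) : Prop where
  pos : 0 < M
  abs_alpha_le : |α| ≤ M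
  mul_lt : lamInf * (sInf + M ^ 2) < 1
  prim_le : satPrim (lam 0) (s 0) α ≤ satPrim lamInf sInf M

section

variable {lam s : ℝ → ℝ} {lamInf sInf : ℝ}

theorem Coefficients.kappa_pos (h : Coefficients lam s lamInf sInf) {M : ℝ}
    (hM : lamInf * (sInf + M ^ 2) < 1) : 0 < 1 / (sInf + M ^ 2) - lamInf := by
  have := h.sInf_pos
  rw [sub_pos, lt_div_iff₀ (by positivity)]
  exact hM

theorem Coefficients.kappa_satPrim_inf_le (h : Coefficients lam s lamInf sInf) {M z : ℝ}
    (hz : |z| ≤ M) :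
    (1 / (sInf + M ^ 2) - lamInf) * z ^ 2 / 2 ≤ satPrim lamInf sInf z := by
  have := h.le_satNonlin_inf_mul hz
  have := half_satNonlin_mul_le_satPrim (l := lamInf) h.sInf_pos z
  linarith

theorem Confines.isAdmissible (h : Coefficients lam s lamInf sInf) {α M : ℝ}
    (hM : Confines lam s lamInf sInf α M) : IsAdmissible lam s lamInf sInf α M M := by
  refine ⟨hM.pos, hM.pos, abs_le.1 hM.abs_alpha_le, ⟨1 / (sInf + M ^ 2) - lamInf, lipBound lam s lamInf,
    h.kappa_pos hM.mul_lt, h.lipBound_pos, fun r hr z hz => ⟨h.le_satNonlin_inf_mul (abs_le.2 hz),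
      h.satNonlin_inf_mul_le hr z, h.satNonlin_mul_le hr z⟩⟩, ?_⟩
  rw [satPrim_neg h.sInf_pos, min_self]
  exact hM.prim_le

theorem mul_lt_one_of_kappa_le (hs : 0 < sInf) {κ z : ℝ} (hκ : 0 < κ) (hz : 0 < z ^ 2)
    (hle : κ * z ^ 2 ≤ satNonlin lamInf sInf z * z) : lamInf * (sInf + z ^ 2) < 1 := by
  rw [satNonlin_mul_self] at hle
  have h1 := le_of_mul_le_mul_right hle hz
  have h2 : 0 < sInf + z ^ 2 := by positivity
  have h3 : lamInf < 1 / (sInf + z ^ 2) := by linarith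
  rwa [lt_div_iff₀ h2] at h3

/-- As `G_∞` is even, the smaller of `a`, `b` already satisfies the energy condition. If `|α|`
exceeded it, strict monotonicity would give `G_∞(α) > G_∞(min a b) ≥ G(0, α)`, contradicting `G_∞ ≤
G(0, ·)`. -/
theorem IsAdmissible.confines (h : Coefficients lam s lamInf sInf) {α a b : ℝ}
    (hab : IsAdmissible lam s lamInf sInf α a b) :
    Confines lam s lamInf sInf α (min a b) := by
  obtain ⟨ha, hb, hα, ⟨κ, K, hκ, hK, hz⟩, hG⟩ := hab
  rw [satPrim_neg h.sInf_pos] at hG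
  have hA : lamInf * (sInf + a ^ 2) < 1 := by
    have := (hz 0 le_rfl (-a) ⟨le_rfl, by linarith⟩).1
    simpa using mul_lt_one_of_kappa_le h.sInf_pos hκ (by nlinarith) this
  have hB : lamInf * (sInf + b ^ 2) < 1 :=
    mul_lt_one_of_kappa_le h.sInf_pos hκ (by positivity) (hz 0 le_rfl b ⟨by linarith, le_rfl⟩).1
  have hG' : satPrim (lam 0) (s 0) α ≤ satPrim lamInf sInf (min a b) := by
    rcases min_choice a b with e | e <;> rw [e]
    · exact hG.trans (min_le_left _ _)
    · exact hG.trans (min_le_right _ _)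
  have hmin : lamInf * (sInf + (min a b) ^ 2) < 1 := by
    rcases min_choice a b with e | e <;> rw [e] <;> assumption
  have hmax : lamInf * (sInf + (max a b) ^ 2) < 1 := by
    rcases max_choice a b with e | e <;> rw [e] <;> assumption
  refine ⟨lt_min ha hb, ?_, hmin, hG'⟩
  by_contra! hlt
  have hαm : |α| ≤ max a b := abs_le.2
    ⟨by linarith [hα.1, le_max_left a b], hα.2.trans (le_max_right a b)⟩
  have := satPrim_strictMonoOn h.sInf_pos hmax ⟨(lt_min ha hb).le, min_le_max⟩
    ⟨abs_nonneg α, hαm⟩ hlt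
  rw [satPrim_abs h.sInf_pos] at this
  linarith [h.satPrim_inf_le le_rfl α]

end

end SaturableHelmholtz

/-! ### Part: the radial initial value problem. -/

namespace SaturableHelmholtz

/-- The weighted average `∫₀¹ θⁿ f(tθ) dθ`. -/
noncomputable def radialAverage (n : ℕ) (f : ℝ → ℝ) (t : ℝ) : ℝ :=
  ∫ θ in (0 : ℝ)..1, θ ^ n * f (t * θ)

section radialAverage

variable {n : ℕ} {f : ℝ → ℝ}

theorem continuous_radialAverage (hf : Continuous f) : Continuous (radialAverage n f) := by
  unfold radialAverage
  apply intervalIntegral.continuous_parametric_intervalIntegral_of_continuous'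
  fun_prop

theorem radialAverage_even (hf : Function.Even f) : Function.Even (radialAverage n f) := by
  intro t
  unfold radialAverage
  congr 1
  ext θ
  rw [neg_mul, hf]

theorem radialAverage_zero_right : radialAverage n f 0 = f 0 / (n + 1) := by
  unfold radialAverage
  simp only [zero_mul]
  rw [intervalIntegral.integral_mul_const, integral_pow]
  simp; ring

/-- Substituting `τ = t θ` identifies `t * radialAverage n f t` with `t⁻ⁿ ∫₀ᵗ τⁿ f`, the derivative
of the solution of `(rⁿ v')' = rⁿ f`. The averaged form has no singularity at the origin. -/
theorem pow_mul_radialAverage (t : ℝ) :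
    t ^ (n + 1) * radialAverage n f t = ∫ τ in (0 : ℝ)..t, τ ^ n * f τ := by
  have h := intervalIntegral.mul_integral_comp_mul_left (f := fun τ => τ ^ n * f τ)
    (a := 0) (b := 1) t
  simp only [mul_zero, mul_one] at h
  rw [← h, pow_succ', mul_assoc]
  unfold radialAverage
  rw [← intervalIntegral.integral_const_mul]
  simp only [mul_pow, mul_assoc]

theorem hasDerivAt_radialAverage (hf : Continuous f) {t : ℝ} (ht : t ≠ 0) :
    HasDerivAt (radialAverage n f) ((f t - (n + 1) * radialAverage n f t) / t) t := by
  have hc : Continuous fun τ : ℝ => τ ^ n * f τ := by fun_prop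
  have h1 : HasDerivAt (fun t => ∫ τ in (0 : ℝ)..t, τ ^ n * f τ) (t ^ n * f t) t :=
    intervalIntegral.integral_hasDerivAt_right (hc.intervalIntegrable _ _)
      (hc.stronglyMeasurableAtFilter _ _) hc.continuousAt
  have h2 := h1.div (hasDerivAt_pow (n + 1) t) (pow_ne_zero _ ht)
  have h3 : radialAverage n f =ᶠ[𝓝 t] fun t => (∫ τ in (0 : ℝ)..t, τ ^ n * f τ) / t ^ (n + 1) := by
    filter_upwards [isOpen_ne.mem_nhds ht] with x hx
    rw [eq_div_iff (pow_ne_zero _ hx), mul_comm, pow_mul_radialAverage]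
  refine (h2.congr_of_eventuallyEq h3).congr_deriv ?_
  rw [← pow_mul_radialAverage]
  push_cast
  field_simp
  ring

theorem hasDerivAt_mul_radialAverage (hf : Continuous f) (t : ℝ) :
    HasDerivAt (fun t => t * radialAverage n f t) (f t - n * radialAverage n f t) t := by
  rcases eq_or_ne t 0 with rfl | ht
  · have h0 : f 0 - n * radialAverage n f 0 = radialAverage n f 0 := by
      rw [radialAverage_zero_right]; field_simp; ring
    -- At the origin the difference quotient of `t * radialAverage n f t` is the average itself, so
    -- its continuity gives the derivative.
    rw [h0, hasDerivAt_iff_tendsto_slope]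
    refine (((continuous_radialAverage hf).tendsto 0).mono_left nhdsWithin_le_nhds).congr' ?_
    filter_upwards [self_mem_nhdsWithin] with x hx
    rw [slope_def_field]
    have : x ≠ 0 := hx
    field_simp
    simp
  · refine ((hasDerivAt_id t).mul (hasDerivAt_radialAverage hf ht)).congr_deriv ?_
    simp only [id]
    field_simp
    ring

theorem abs_radialAverage_le {t B : ℝ} (h : ∀ τ, |τ| ≤ |t| → |f τ| ≤ B) :
    |radialAverage n f t| ≤ B := by
  have hB : 0 ≤ B := (abs_nonneg _).trans (h t le_rfl)
  have := intervalIntegral.norm_integral_le_of_norm_le_const (a := 0) (b := 1) (C := B)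
    (f := fun θ : ℝ => θ ^ n * f (t * θ)) ?_
  · simpa [radialAverage] using this
  · intro θ hθ
    rw [uIoc_of_le zero_le_one] at hθ
    rw [norm_mul, Real.norm_eq_abs, Real.norm_eq_abs]
    have h1 : |θ ^ n| ≤ 1 := by
      rw [abs_of_nonneg (pow_nonneg hθ.1.le n)]
      exact pow_le_one₀ hθ.1.le hθ.2
    have h2 : |f (t * θ)| ≤ B := by
      apply h
      rw [abs_mul, abs_of_pos hθ.1]
      exact mul_le_of_le_one_right (abs_nonneg t) hθ.2
    calc |θ ^ n| * |f (t * θ)| ≤ 1 * B := by gcongr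
      _ = B := one_mul B

theorem radialAverage_sub {f₁ f₂ : ℝ → ℝ} (h₁ : Continuous f₁) (h₂ : Continuous f₂) (t : ℝ) :
    radialAverage n (fun r => f₁ r - f₂ r) t = radialAverage n f₁ t - radialAverage n f₂ t := by
  unfold radialAverage
  rw [← intervalIntegral.integral_sub]
  · simp only [mul_sub]
  · exact (by fun_prop : Continuous fun θ : ℝ => θ ^ n * f₁ (t * θ)).intervalIntegrable _ _
  · exact (by fun_prop : Continuous fun θ : ℝ => θ ^ n * f₂ (t * θ)).intervalIntegrable _ _

/-- The inverse of the radial Laplacian, applied to `f`, with value `0` at the origin. -/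
noncomputable def radialPotential (n : ℕ) (f : ℝ → ℝ) (r : ℝ) : ℝ :=
  ∫ t in (0 : ℝ)..r, t * radialAverage n f t

theorem hasDerivAt_radialPotential (hf : Continuous f) (r : ℝ) :
    HasDerivAt (radialPotential n f) (r * radialAverage n f r) r := by
  have hc : Continuous fun t => t * radialAverage n f t :=
    continuous_id.mul (continuous_radialAverage hf)
  exact intervalIntegral.integral_hasDerivAt_right (hc.intervalIntegrable _ _)
      (hc.stronglyMeasurableAtFilter _ _) hc.continuousAt

theorem continuous_radialPotential (hf : Continuous f) : Continuous (radialPotential n f) :=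
  continuous_iff_continuousAt.2 fun r => (hasDerivAt_radialPotential hf r).continuousAt

theorem radialPotential_even (hf : Function.Even f) : Function.Even (radialPotential n f) := by
  intro r
  unfold radialPotential
  have h := intervalIntegral.integral_comp_neg (a := 0) (b := r)
    (fun t => t * radialAverage n f t)
  simp only [radialAverage_even hf _, neg_mul, intervalIntegral.integral_neg, neg_zero] at h
  rw [intervalIntegral.integral_symm, ← h, neg_neg]

theorem radialPotential_sub {f₁ f₂ : ℝ → ℝ} (h₁ : Continuous f₁) (h₂ : Continuous f₂) (r : ℝ) :
    radialPotential n (fun r => f₁ r - f₂ r) r = radialPotential n f₁ r - radialPotential n f₂ r := by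
  unfold radialPotential
  rw [← intervalIntegral.integral_sub]
  · simp only [radialAverage_sub h₁ h₂, mul_sub]
  · exact (continuous_id.mul (continuous_radialAverage h₁)).intervalIntegrable _ _
  · exact (continuous_id.mul (continuous_radialAverage h₂)).intervalIntegrable _ _

/-- The radial potential gains a factor `1 / (2K)` with respect to the weight `exp (K r²)`. -/
theorem abs_radialPotential_le {K d : ℝ} (hK : 0 < K)
    (h : ∀ r, |f r| ≤ K * d * Real.exp (K * r ^ 2)) {r : ℝ} (hr : 0 ≤ r) :
    |radialPotential n f r| ≤ d / 2 * Real.exp (K * r ^ 2) := by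
  have hd : 0 ≤ d := by
    have := (abs_nonneg _).trans (h 0)
    simp only [ne_eq, OfNat.ofNat_ne_zero, not_false_eq_true, zero_pow, mul_zero, Real.exp_zero,
      mul_one] at this
    exact nonneg_of_mul_nonneg_right this hK
  have hder : ∀ t : ℝ, HasDerivAt (fun t => d / 2 * Real.exp (K * t ^ 2))
      (K * d * (t * Real.exp (K * t ^ 2))) t := by
    intro t
    refine ((((hasDerivAt_pow 2 t).const_mul K).exp).const_mul (d / 2)).congr_deriv ?_
    push_cast; ring
  have hc : Continuous fun t : ℝ => K * d * (t * Real.exp (K * t ^ 2)) := by fun_prop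
  have hb := intervalIntegral.norm_integral_le_of_norm_le (μ := MeasureTheory.volume) hr
    (f := fun t => t * radialAverage n f t) (g := fun t => K * d * (t * Real.exp (K * t ^ 2)))
    (Filter.Eventually.of_forall fun t ht => ?_) (hc.intervalIntegrable _ _)
  · rw [intervalIntegral.integral_eq_sub_of_hasDerivAt (fun t _ => hder t)
      (hc.intervalIntegrable _ _)] at hb
    refine (hb.trans ?_)
    have : 0 ≤ d / 2 * Real.exp (K * 0 ^ 2) := by positivity
    linarith
  · rw [norm_mul, Real.norm_eq_abs, Real.norm_eq_abs, abs_of_pos ht.1]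
    have : |radialAverage n f t| ≤ K * d * Real.exp (K * t ^ 2) := by
      apply abs_radialAverage_le
      intro τ hτ
      refine (h τ).trans ?_
      have : τ ^ 2 ≤ t ^ 2 := sq_le_sq.2 hτ
      gcongr
    nlinarith [ht.1]

end radialAverage

/-- `u` is an even solution of `u'' + (n / r) u' + g(r, u) = 0` on `ℝ` with `u(0) = α`,
and `q` is the continuous extension of `u' / r`. -/
structure IsRadialProfile (n : ℕ) (g : ℝ → ℝ → ℝ) (α : ℝ) (u q : ℝ → ℝ) : Prop where
  even_u : Function.Even u
  even_q : Function.Even q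
  continuous_q : Continuous q
  u_zero : u 0 = α
  q_zero : q 0 = -g 0 (u 0) / (n + 1)
  hasDerivAt_u : ∀ r, HasDerivAt u (r * q r) r
  hasDerivAt_mul_q : ∀ r, HasDerivAt (fun r => r * q r) (-g r (u r) - n * q r) r
  hasDerivAt_q : ∀ r, r ≠ 0 → HasDerivAt q (-(g r (u r) + (n + 1) * q r) / r) r

open BoundedContinuousFunction in
/-- Global solvability of the radial initial value problem, with explicit Lipschitz dependence on
the initial value. -/
theorem exists_isRadialProfile (n : ℕ) {g : ℝ → ℝ → ℝ} (hg : Continuous fun p : ℝ × ℝ => g p.1 p.2)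
    {K : ℝ} (hK : 0 < K) (hlip : ∀ r z y, |g r z - g r y| ≤ K * |z - y|) (hzero : ∀ r, g r 0 = 0)
    (heven : ∀ r z, g (-r) z = g r z) :
    ∃ u q : ℝ → ℝ → ℝ, (∀ α, IsRadialProfile n g α (u α) (q α)) ∧
      (∀ α β r, |u α r - u β r| ≤ 2 * |α - β| * Real.exp (K * r ^ 2)) ∧
      (∀ α β r, |q α r - q β r| ≤ K * (2 * |α - β|) * Real.exp (K * r ^ 2)) := by
  -- The unknown is `exp (K r²) * w` with `w` bounded. In this weight the Picard map contracts by `1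
  -- / 2` on the whole line at once, so no continuation argument is needed.
  let U : (ℝ →ᵇ ℝ) → ℝ → ℝ := fun w r => Real.exp (K * r ^ 2) * w r
  let f : (ℝ →ᵇ ℝ) → ℝ → ℝ := fun w r => g r (U w r)
  have hU : ∀ w, Continuous (U w) := fun w => by
    have := w.continuous
    fun_prop
  have hf : ∀ w, Continuous (f w) := fun w =>
    hg.comp (continuous_id.prodMk (hU w))
  have hfd : ∀ w v : ℝ →ᵇ ℝ, ∀ r, |f w r - f v r| ≤ K * dist w v * Real.exp (K * r ^ 2) := by
    intro w v r
    refine (hlip r _ _).trans ?_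
    have h1 : |w r - v r| ≤ dist w v := dist_coe_le_dist (f := w) (g := v) r
    have h2 : |U w r - U v r| = Real.exp (K * r ^ 2) * |w r - v r| := by
      rw [← mul_sub, abs_mul, abs_of_pos (Real.exp_pos _)]
    rw [h2, mul_assoc, mul_comm (dist w v)]
    gcongr
  have hf0 : ∀ r, f 0 r = 0 := fun r => by simp [f, U, hzero]
  have hpot : ∀ w v : ℝ →ᵇ ℝ, ∀ r, |radialPotential n (f w) (|r|) - radialPotential n (f v) (|r|)|
      ≤ dist w v / 2 * Real.exp (K * r ^ 2) := by
    intro w v r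
    rw [← radialPotential_sub (hf w) (hf v)]
    have := abs_radialPotential_le (n := n) hK (hfd w v) (abs_nonneg r)
    rwa [sq_abs] at this
  have hpot0 : ∀ r, radialPotential n (f 0) r = 0 := fun r => by
    simp [radialPotential, radialAverage, hf0]
  have hbound : ∀ (α : ℝ) (w : ℝ →ᵇ ℝ) (r : ℝ),
      ‖Real.exp (-(K * r ^ 2)) * (α - radialPotential n (f w) |r|)‖ ≤ |α| + dist w 0 / 2 := by
    intro α w r
    have h1 := hpot w 0 r
    rw [hpot0, sub_zero] at h1
    rw [norm_mul, Real.norm_eq_abs, Real.norm_eq_abs, abs_of_pos (Real.exp_pos _)]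
    have h2 : Real.exp (-(K * r ^ 2)) ≤ 1 := Real.exp_le_one_iff.2 (by
      have : 0 ≤ K * r ^ 2 := by positivity
      linarith)
    calc Real.exp (-(K * r ^ 2)) * |α - radialPotential n (f w) (|r|)|
        ≤ Real.exp (-(K * r ^ 2)) * (|α| + dist w 0 / 2 * Real.exp (K * r ^ 2)) := by
          gcongr
          exact (abs_sub _ _).trans (by linarith)
      _ = Real.exp (-(K * r ^ 2)) * |α| +
            dist w 0 / 2 * (Real.exp (-(K * r ^ 2)) * Real.exp (K * r ^ 2)) := by ring
      _ ≤ _ := by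
          rw [← Real.exp_add, neg_add_cancel, Real.exp_zero, mul_one]
          have := mul_le_mul_of_nonneg_right h2 (abs_nonneg α)
          linarith
  -- Evaluating the potential at `|r|` makes every image even, so the fixed point is even without
  -- restricting the space. Once it is even, the modulus can be dropped and the map differentiated
  -- at `0`.
  let T : ℝ → (ℝ →ᵇ ℝ) → (ℝ →ᵇ ℝ) := fun α w =>
    BoundedContinuousFunction.ofNormedAddCommGroup
      (fun r => Real.exp (-(K * r ^ 2)) * (α - radialPotential n (f w) |r|))
      ((by fun_prop : Continuous fun r : ℝ => Real.exp (-(K * r ^ 2))).mul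
        (continuous_const.sub ((continuous_radialPotential (hf w)).comp continuous_abs)))
      (|α| + dist w 0 / 2) (hbound α w)
  have hT : ∀ α w r, T α w r = Real.exp (-(K * r ^ 2)) * (α - radialPotential n (f w) |r|) :=
    fun _ _ _ => rfl
  have hTdist : ∀ α β w v, dist (T α w) (T β v) ≤ |α - β| + dist w v / 2 := by
    intro α β w v
    rw [dist_le (by positivity)]
    intro r
    rw [Real.dist_eq, hT, hT, ← mul_sub, abs_mul, abs_of_pos (Real.exp_pos _)]
    have h2 : Real.exp (-(K * r ^ 2)) ≤ 1 := Real.exp_le_one_iff.2 (by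
      have : 0 ≤ K * r ^ 2 := by positivity
      linarith)
    calc Real.exp (-(K * r ^ 2)) *
          |α - radialPotential n (f w) |r| - (β - radialPotential n (f v) |r|)|
        ≤ Real.exp (-(K * r ^ 2)) * (|α - β| + dist w v / 2 * Real.exp (K * r ^ 2)) := by
          gcongr
          rw [sub_sub_sub_comm]
          exact (abs_sub _ _).trans (by linarith [hpot w v r])
      _ = Real.exp (-(K * r ^ 2)) * |α - β| +
            dist w v / 2 * (Real.exp (-(K * r ^ 2)) * Real.exp (K * r ^ 2)) := by ring
      _ ≤ _ := by
          rw [← Real.exp_add, neg_add_cancel, Real.exp_zero, mul_one]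
          have := mul_le_mul_of_nonneg_right h2 (abs_nonneg (α - β))
          linarith
  have hcontr : ∀ α, ContractingWith (1 / 2 : NNReal) (T α) := fun α =>
    ⟨by
      rw [← NNReal.coe_lt_coe]; norm_num, LipschitzWith.of_dist_le_mul fun w v => by
      have := hTdist α α w v
      simp only [sub_self, abs_zero, zero_add] at this
      simpa [div_eq_inv_mul] using this⟩
  choose w hw using fun α => (⟨_, (hcontr α).fixedPoint_isFixedPt⟩ : ∃ w, T α w = w)
  have hUeq : ∀ α r, U (w α) r = α - radialPotential n (f (w α)) |r| := by
    intro α r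
    have h1 := hT α (w α) r
    rw [hw] at h1
    change Real.exp (K * r ^ 2) * w α r = _
    rw [h1, ← mul_assoc, ← Real.exp_add, add_neg_cancel, Real.exp_zero, one_mul]
  have hUev : ∀ α, Function.Even (U (w α)) := fun α r => by rw [hUeq, hUeq, abs_neg]
  have hfev : ∀ α, Function.Even (f (w α)) := fun α r => by
    simp only [f]; rw [heven, hUev]
  have hUeq' : ∀ α r, U (w α) r = α - radialPotential n (f (w α)) r := by
    intro α r
    rw [hUeq]
    rcases abs_choice r with e | e <;> rw [e]
    rw [radialPotential_even (hfev α)]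
  -- The factor `2` is `1 / (1 - 1/2)`: half of the distance is absorbed into the left side.
  have hwd : ∀ α β, dist (w α) (w β) ≤ 2 * |α - β| := by
    intro α β
    have := hTdist α β (w α) (w β)
    rw [hw, hw] at this
    linarith
  refine ⟨fun α => U (w α), fun α r => -radialAverage n (f (w α)) r, fun α => ?_, ?_, ?_⟩
  · change IsRadialProfile n g α (U (w α)) fun r => -radialAverage n (f (w α)) r
    have hd : ∀ r, HasDerivAt (U (w α)) (r * -radialAverage n (f (w α)) r) r := by
      intro r
      rw [show U (w α) = fun r => α - radialPotential n (f (w α)) r from funext (hUeq' α)]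
      exact ((hasDerivAt_radialPotential (hf (w α)) r).const_sub α).congr_deriv (by ring)
    refine ⟨hUev α, ?_, (continuous_radialAverage (hf _)).neg, ?_, ?_, hd, ?_, ?_⟩
    · intro r
      change -radialAverage n (f (w α)) (-r) = _
      rw [radialAverage_even (hfev α)]
    · rw [hUeq']; simp [radialPotential]
    · rw [radialAverage_zero_right, neg_div]
    · intro r
      simp only [mul_neg]
      exact (hasDerivAt_mul_radialAverage (hf (w α)) r).neg.congr_deriv (by simp only [f]; ring)
    · intro r hr
      refine (hasDerivAt_radialAverage (hf (w α)) hr).neg.congr_deriv ?_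
      simp only [f]; field_simp; ring
  · intro α β r
    change |Real.exp (K * r ^ 2) * w α r - Real.exp (K * r ^ 2) * w β r| ≤ _
    rw [← mul_sub, abs_mul, abs_of_pos (Real.exp_pos _), mul_comm]
    gcongr
    exact (dist_coe_le_dist (f := w α) (g := w β) r).trans (hwd α β)
  · intro α β r
    change |-radialAverage n (f (w α)) r - -radialAverage n (f (w β)) r| ≤ _
    rw [neg_sub_neg, abs_sub_comm, ← radialAverage_sub (hf _) (hf _)]
    apply abs_radialAverage_le
    intro τ hτ
    refine (hfd _ _ τ).trans ?_
    have : τ ^ 2 ≤ r ^ 2 := sq_le_sq.2 hτ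
    have := hwd α β
    gcongr

end SaturableHelmholtz

/-! ### Part: from radial profiles to `C²` functions and their Laplacians. -/

namespace SaturableHelmholtz

section Radial

set_option maxSynthPendingDepth 3

variable {E : Type*} [NormedAddCommGroup E] [InnerProductSpace ℝ E]

/-- The real inner product as a continuous bilinear map. -/
noncomputable def innerBilin : E →L[ℝ] E →L[ℝ] ℝ := innerSL ℝ

theorem innerBilin_apply (x y : E) : innerBilin x y = inner ℝ x y := rfl

theorem norm_innerBilin_apply (x : E) : ‖innerBilin x‖ = ‖x‖ := innerSL_apply_norm (𝕜 := ℝ) x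

theorem norm_innerBilin_le : ‖(innerBilin : E →L[ℝ] E →L[ℝ] ℝ)‖ ≤ 1 :=
  ContinuousLinearMap.opNorm_le_bound _ zero_le_one fun x => by
    rw [norm_innerBilin_apply, one_mul]

theorem hasFDerivAt_norm_of_ne_zero {x : E} (hx : x ≠ 0) :
    HasFDerivAt (fun x : E => ‖x‖) (‖x‖⁻¹ • innerBilin x) x := by
  have h := (hasStrictFDerivAt_norm_sq x).hasFDerivAt.sqrt (by simpa using hx)
  have e : (fun x : E => √(‖x‖ ^ 2)) = fun x : E => ‖x‖ := by
    ext y; exact Real.sqrt_sq (norm_nonneg y)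
  rw [e, Real.sqrt_sq (norm_nonneg x)] at h
  refine h.congr_fderiv ?_
  ext y
  simp only [smul_apply, innerBilin_apply, innerSL_apply_apply, smul_eq_mul,
    nsmul_eq_mul]
  push_cast
  ring

theorem hasFDerivAt_comp_norm {φ : ℝ → ℝ} {φ' : ℝ} {x : E} (hx : x ≠ 0)
    (h : HasDerivAt φ φ' ‖x‖) :
    HasFDerivAt (fun x : E => φ ‖x‖) ((φ' / ‖x‖) • innerBilin x) x := by
  refine (h.comp_hasFDerivAt x (hasFDerivAt_norm_of_ne_zero hx)).congr_fderiv ?_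
  rw [smul_smul, div_eq_mul_inv]

theorem hasFDerivAt_comp_norm_zero {φ : ℝ → ℝ} (h : HasDerivAt φ 0 0) :
    HasFDerivAt (fun x : E => φ ‖x‖) (0 : E →L[ℝ] ℝ) 0 := by
  rw [hasFDerivAt_iff_isLittleO_nhds_zero]
  rw [hasDerivAt_iff_isLittleO_nhds_zero] at h
  have := (h.comp_tendsto (tendsto_norm_zero (E := E))).of_norm_right
  simpa [Function.comp_def] using this

/-- Continuity of `c` suffices because the factor `innerBilin x` vanishes linearly at the origin.
This gives the Hessian at `0`, where no derivative of `q` is available. -/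
theorem hasFDerivAt_smul_innerBilin_zero {c : E → ℝ} (hc : ContinuousAt c 0) :
    HasFDerivAt (fun x => c x • (innerBilin x : E →L[ℝ] ℝ)) (c 0 • innerBilin) 0 := by
  rw [hasFDerivAt_iff_isLittleO_nhds_zero]
  have h1 : (fun x => c x - c 0) =o[𝓝 0] fun _ => (1 : ℝ) :=
    (Asymptotics.isLittleO_one_iff ℝ).2 (tendsto_sub_nhds_zero_iff.2 hc)
  have h2 : (fun x : E => innerBilin x) =O[𝓝 0] fun x => x := innerBilin.isBigO_id _
  refine (h1.smul_isBigO h2).norm_right.congr_left ?_ |>.trans_le ?_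
  · intro x
    simp [sub_smul]
  · intro x
    simp

/-- The Hessian of a radial function with `q = φ' / r` and `h = φ'' - φ' / r`. -/
noncomputable def radialHessian (q h : ℝ → ℝ) (x : E) : E →L[ℝ] E →L[ℝ] ℝ :=
  q ‖x‖ • innerBilin + (h ‖x‖ / ‖x‖ ^ 2) • (innerBilin x).smulRight (innerBilin x)

theorem norm_smulRight_innerBilin_le (c : ℝ) (x : E) :
    ‖(c / ‖x‖ ^ 2) • (innerBilin x).smulRight (innerBilin x)‖ ≤ |c| := by
  rw [norm_smul, ContinuousLinearMap.norm_smulRight_apply, norm_innerBilin_apply, Real.norm_eq_abs,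
    abs_div, abs_pow, abs_norm, ← sq]
  rcases eq_or_ne (‖x‖ ^ 2) 0 with h | h
  · rw [h, mul_zero]; exact abs_nonneg c
  · rw [div_mul_cancel₀ _ h]

theorem norm_radialHessian_le (q h : ℝ → ℝ) (x : E) :
    ‖radialHessian q h x‖ ≤ |q ‖x‖| + |h ‖x‖| := by
  refine (norm_add_le _ _).trans (add_le_add ?_ (norm_smulRight_innerBilin_le _ _))
  rw [norm_smul, Real.norm_eq_abs]
  exact mul_le_of_le_one_right (abs_nonneg _) norm_innerBilin_le

theorem radialHessian_sub (q₁ h₁ q₂ h₂ : ℝ → ℝ) (x : E) :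
    radialHessian q₁ h₁ x - radialHessian q₂ h₂ x =
      radialHessian (fun r => q₁ r - q₂ r) (fun r => h₁ r - h₂ r) x := by
  ext y z
  simp only [radialHessian, sub_apply, add_apply, smul_apply, smul_eq_mul]
  ring

/-- The rank-one term has norm at most `|h ‖x‖|`, so `h 0 = 0` makes it tend to `0` at the origin
although its direction has no limit there. -/
theorem continuous_radialHessian {q h : ℝ → ℝ} (hq : Continuous q) (hh : Continuous h)
    (h0 : h 0 = 0) : Continuous (radialHessian q h : E → E →L[ℝ] E →L[ℝ] ℝ) := by
  refine ((hq.comp continuous_norm).smul continuous_const).add (continuous_iff_continuousAt.2 ?_)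
  intro x
  rcases eq_or_ne x 0 with rfl | hx
  · have h1 : Tendsto (fun x : E => |h ‖x‖|) (𝓝 0) (𝓝 0) := by
      have := ((hh.comp (continuous_norm (E := E))).abs).tendsto 0
      simpa [h0] using this
    have h2 : Tendsto (fun x : E => (h ‖x‖ / ‖x‖ ^ 2) • (innerBilin x).smulRight (innerBilin x))
        (𝓝 0) (𝓝 0) :=
      squeeze_zero_norm (fun x => norm_smulRight_innerBilin_le _ x) h1
    simpa [ContinuousAt] using h2
  · have h1 : ContinuousAt (fun x : E => h ‖x‖ / ‖x‖ ^ 2) x :=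
      ContinuousAt.div (hh.comp continuous_norm).continuousAt
        (continuous_norm.pow 2).continuousAt (pow_ne_zero 2 (norm_ne_zero_iff.2 hx))
    have h2 : Continuous fun x : E => ContinuousLinearMap.smulRightL ℝ E (E →L[ℝ] ℝ)
        (innerBilin x) (innerBilin x) := by fun_prop
    exact h1.smul h2.continuousAt

end Radial

namespace IsRadialProfile

variable {n : ℕ} {g : ℝ → ℝ → ℝ} {α : ℝ} {u q : ℝ → ℝ}

/-- The difference `u'' - u' / r` of a radial profile. -/
def anisotropy (n : ℕ) (g : ℝ → ℝ → ℝ) (u q : ℝ → ℝ) (r : ℝ) : ℝ :=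
  -(g r (u r) + (n + 1) * q r)

theorem continuous_u (h : IsRadialProfile n g α u q) : Continuous u :=
  continuous_iff_continuousAt.2 fun r => (h.hasDerivAt_u r).continuousAt

theorem deriv_u (h : IsRadialProfile n g α u q) : deriv u = fun r => r * q r :=
  funext fun r => (h.hasDerivAt_u r).deriv

theorem deriv_deriv_u (h : IsRadialProfile n g α u q) :
    deriv (deriv u) = fun r => -g r (u r) - n * q r := by
  rw [h.deriv_u]
  exact funext fun r => (h.hasDerivAt_mul_q r).deriv

theorem continuous_comp (h : IsRadialProfile n g α u q)
    (hg : Continuous fun p : ℝ × ℝ => g p.1 p.2) : Continuous fun r => g r (u r) :=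
  hg.comp (continuous_id.prodMk h.continuous_u)

theorem contDiff (h : IsRadialProfile n g α u q) (hg : Continuous fun p : ℝ × ℝ => g p.1 p.2) :
    ContDiff ℝ 2 u := by
  rw [show (2 : WithTop ℕ∞) = 1 + 1 by norm_num, contDiff_succ_iff_deriv]
  refine ⟨fun r => (h.hasDerivAt_u r).differentiableAt, by simp, contDiff_one_iff_deriv.2 ⟨?_, ?_⟩⟩
  · rw [h.deriv_u]
    exact fun r => (h.hasDerivAt_mul_q r).differentiableAt
  · rw [h.deriv_deriv_u]
    exact (h.continuous_comp hg).neg.sub (continuous_const.mul h.continuous_q)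

/-- The prescribed value of `q 0` is exactly the one that removes the direction-dependent part of
the Hessian at the origin. -/
theorem anisotropy_zero (h : IsRadialProfile n g α u q) : anisotropy n g u q 0 = 0 := by
  unfold anisotropy
  rw [h.q_zero]
  field_simp
  ring

theorem continuous_anisotropy (h : IsRadialProfile n g α u q)
    (hg : Continuous fun p : ℝ × ℝ => g p.1 p.2) : Continuous (anisotropy n g u q) :=
  ((h.continuous_comp hg).add (continuous_const.mul h.continuous_q)).neg

section

variable {E : Type*} [NormedAddCommGroup E] [InnerProductSpace ℝ E]

theorem hasFDerivAt (h : IsRadialProfile n g α u q) (x : E) :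
    HasFDerivAt (fun x : E => u ‖x‖) (q ‖x‖ • innerBilin x) x := by
  rcases eq_or_ne x 0 with rfl | hx
  · have := hasFDerivAt_comp_norm_zero (E := E) (φ := u) (by simpa using h.hasDerivAt_u 0)
    simpa using this
  · refine (hasFDerivAt_comp_norm hx (h.hasDerivAt_u ‖x‖)).congr_fderiv ?_
    rw [mul_div_cancel_left₀ _ (norm_ne_zero_iff.2 hx)]

theorem hasFDerivAt_fderiv (h : IsRadialProfile n g α u q) (x : E) :
    HasFDerivAt (fun x : E => q ‖x‖ • (innerBilin x : E →L[ℝ] ℝ))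
      (radialHessian q (anisotropy n g u q) x) x := by
  rcases eq_or_ne x 0 with rfl | hx
  · have := hasFDerivAt_smul_innerBilin_zero
      (h.continuous_q.comp (continuous_norm (E := E))).continuousAt
    refine this.congr_fderiv ?_
    ext y z
    simp [radialHessian]
  · have hx' : ‖x‖ ≠ 0 := norm_ne_zero_iff.2 hx
    refine ((hasFDerivAt_comp_norm hx (h.hasDerivAt_q ‖x‖ hx')).smul
      (innerBilin (E := E)).hasFDerivAt).congr_fderiv ?_
    ext y z
    simp only [radialHessian, anisotropy, add_apply,
      smul_apply, ContinuousLinearMap.smulRight_apply, smul_eq_mul]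
    field_simp

theorem fderiv_eq (h : IsRadialProfile n g α u q) :
    fderiv ℝ (fun x : E => u ‖x‖) = fun x => q ‖x‖ • innerBilin x :=
  funext fun x => (h.hasFDerivAt x).fderiv

theorem fderiv_fderiv_eq (h : IsRadialProfile n g α u q) :
    fderiv ℝ (fderiv ℝ (fun x : E => u ‖x‖)) = radialHessian q (anisotropy n g u q) := by
  rw [h.fderiv_eq]
  exact funext fun x => (h.hasFDerivAt_fderiv x).fderiv

theorem contDiff_comp_norm (h : IsRadialProfile n g α u q)
    (hg : Continuous fun p : ℝ × ℝ => g p.1 p.2) : ContDiff ℝ 2 fun x : E => u ‖x‖ := by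
  rw [show (2 : WithTop ℕ∞) = (1 : ℕ) + 1 by norm_num, contDiff_succ_iff_hasFDerivAt]
  refine ⟨_, ?_, h.hasFDerivAt⟩
  exact contDiff_one_iff_hasFDerivAt.2 ⟨_, continuous_radialHessian h.continuous_q
    (h.continuous_anisotropy hg) h.anisotropy_zero, h.hasFDerivAt_fderiv⟩

end

/-- The trace of the Hessian is `(n + 1) q` plus the anisotropy, and the `q` terms cancel. -/
theorem laplacian_eq (h : IsRadialProfile n g α u q) (x : EuclideanSpace ℝ (Fin (n + 1))) :
    Laplacian.laplacian (fun x : EuclideanSpace ℝ (Fin (n + 1)) => u ‖x‖) x = -g ‖x‖ (u ‖x‖) := by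
  rw [InnerProductSpace.laplacian_eq_iteratedFDeriv_orthonormalBasis _
    (EuclideanSpace.basisFun (Fin (n + 1)) ℝ)]
  simp only [iteratedFDeriv_two_apply, h.fderiv_fderiv_eq]
  have h1 : ∀ i, radialHessian q (anisotropy n g u q) x (EuclideanSpace.basisFun (Fin (n + 1)) ℝ i)
      (EuclideanSpace.basisFun (Fin (n + 1)) ℝ i) =
      q ‖x‖ + (anisotropy n g u q ‖x‖ / ‖x‖ ^ 2) * (x i) ^ 2 := by
    intro i
    simp only [radialHessian, add_apply, smul_apply,
      ContinuousLinearMap.smulRight_apply, smul_eq_mul, innerBilin_apply]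
    rw [real_inner_self_eq_norm_sq, OrthonormalBasis.norm_eq_one, real_inner_comm,
      EuclideanSpace.basisFun_inner]
    ring
  simp only [Matrix.cons_val_zero, Matrix.cons_val_one, h1]
  rw [Finset.sum_add_distrib, ← Finset.mul_sum, ← EuclideanSpace.real_norm_sq_eq]
  have h2 : anisotropy n g u q ‖x‖ / ‖x‖ ^ 2 * ‖x‖ ^ 2 = anisotropy n g u q ‖x‖ := by
    rcases eq_or_ne x 0 with rfl | hx
    · simp [h.anisotropy_zero]
    · exact div_mul_cancel₀ _ (pow_ne_zero 2 (norm_ne_zero_iff.2 hx))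
  rw [h2]
  simp [anisotropy]

end IsRadialProfile

end SaturableHelmholtz

/-! ### Part: energy monotonicity and confinement. -/

namespace SaturableHelmholtz

/-- The nonlinearity `g(|r|, z)`. -/
noncomputable def radialNonlin (lam s : ℝ → ℝ) (r z : ℝ) : ℝ := satNonlin (lam |r|) (s |r|) z

/-- The radial derivative of `G(r, z)` at fixed `z`. -/
noncomputable def primRadialDeriv (lam s : ℝ → ℝ) (r z : ℝ) : ℝ :=
  -(deriv lam r * z ^ 2 / 2) - deriv s r * z ^ 2 / (2 * s r * (s r + z ^ 2))

theorem hasDerivAt_of_contDiffOn_Ici {f : ℝ → ℝ} (hf : ContDiffOn ℝ 1 f (Ici 0)) {r : ℝ}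
    (hr : 0 < r) : HasDerivAt f (deriv f r) r :=
  ((hf.contDiffAt (Ici_mem_nhds hr)).differentiableAt one_ne_zero).hasDerivAt

theorem deriv_nonneg_of_monotoneOn_Ici {f : ℝ → ℝ} (hf : MonotoneOn f (Ici 0)) {r : ℝ}
    (hr : 0 < r) : 0 ≤ deriv f r := by
  rw [← derivWithin_of_mem_nhds (Ici_mem_nhds hr)]
  exact hf.derivWithin_nonneg

variable {lam s : ℝ → ℝ} {lamInf sInf : ℝ} {n : ℕ} {α M : ℝ} {u q : ℝ → ℝ}

namespace Coefficients

theorem deriv_lam_nonneg (h : Coefficients lam s lamInf sInf) {r : ℝ} (hr : 0 < r) :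
    0 ≤ deriv lam r := deriv_nonneg_of_monotoneOn_Ici h.monotoneOn_lam hr

theorem deriv_s_nonneg (h : Coefficients lam s lamInf sInf) {r : ℝ} (hr : 0 < r) :
    0 ≤ deriv s r := deriv_nonneg_of_monotoneOn_Ici h.monotoneOn_s hr

theorem primRadialDeriv_nonpos (h : Coefficients lam s lamInf sInf) {r : ℝ} (hr : 0 < r) (z : ℝ) :
    primRadialDeriv lam s r z ≤ 0 := by
  have h1 := h.deriv_lam_nonneg hr
  have h2 := h.deriv_s_nonneg hr
  have h3 := h.s_pos r hr.le
  unfold primRadialDeriv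
  have h4 : 0 ≤ deriv lam r * z ^ 2 / 2 := by positivity
  have h5 : 0 ≤ deriv s r * z ^ 2 / (2 * s r * (s r + z ^ 2)) := by positivity
  linarith

theorem neg_primRadialDeriv_le (h : Coefficients lam s lamInf sInf) {r : ℝ} (hr : 0 < r) (z : ℝ) :
    -primRadialDeriv lam s r z ≤ (1 + 1 / s 0 ^ 2) * (deriv lam r + deriv s r) * z ^ 2 := by
  have h1 := h.deriv_lam_nonneg hr
  have h2 := h.deriv_s_nonneg hr
  have h3 := h.le_s hr.le
  have h4 := h.s_zero_pos
  have h5 : deriv s r * z ^ 2 / (2 * s r * (s r + z ^ 2)) ≤ deriv s r * z ^ 2 / s 0 ^ 2 := by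
    gcongr
    nlinarith [sq_nonneg z]
  have h6 : deriv s r * z ^ 2 / s 0 ^ 2 = 1 / s 0 ^ 2 * (deriv s r * z ^ 2) := by ring
  have h7 : 0 ≤ 1 / s 0 ^ 2 * (deriv lam r * z ^ 2) := by positivity
  have h8 : 0 ≤ deriv s r * z ^ 2 := by positivity
  have h9 : 0 ≤ deriv lam r * z ^ 2 := by positivity
  unfold primRadialDeriv
  nlinarith

theorem hasDerivAt_satPrim_comp (h : Coefficients lam s lamInf sInf) {r p : ℝ} (hr : 0 < r)
    (hu : HasDerivAt u p r) :
    HasDerivAt (fun r => satPrim (lam r) (s r) (u r))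
      (satNonlin (lam r) (s r) (u r) * p + primRadialDeriv lam s r (u r)) r := by
  have hl := hasDerivAt_of_contDiffOn_Ici h.contDiffOn_lam hr
  have hs := hasDerivAt_of_contDiffOn_Ici h.contDiffOn_s hr
  have hsr := h.s_pos r hr.le
  have h1 := ((hl.neg.mul (hu.pow 2)).div_const 2).add
    ((((hu.pow 2).div hs hsr.ne').const_add 1).log (by
      have : 0 < 1 + u r ^ 2 / s r := by positivity
      exact this.ne') |>.div_const 2)
  have h2 : (fun r => satPrim (lam r) (s r) (u r)) =ᶠ[𝓝 r]
      fun r => -lam r * u r ^ 2 / 2 + Real.log (1 + u r ^ 2 / s r) / 2 := by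
    filter_upwards [Ioi_mem_nhds hr] with x hx
    exact satPrim_eq (h.s_pos x (le_of_lt hx)) _
  refine (h1.congr_of_eventuallyEq h2).congr_deriv ?_
  have : 0 < s r + u r ^ 2 := by positivity
  unfold satNonlin primRadialDeriv
  simp only [Pi.neg_apply, Pi.div_apply, Pi.pow_apply]
  push_cast
  field_simp
  ring

theorem continuous_radialNonlin (h : Coefficients lam s lamInf sInf) :
    Continuous fun p : ℝ × ℝ => radialNonlin lam s p.1 p.2 := h.continuous_satNonlin_abs

theorem exists_family (h : Coefficients lam s lamInf sInf) (n : ℕ) :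
    ∃ u q : ℝ → ℝ → ℝ, (∀ α, IsRadialProfile n (radialNonlin lam s) α (u α) (q α)) ∧
      (∀ α β r, |u α r - u β r| ≤
        2 * |α - β| * Real.exp (lipBound lam s lamInf * r ^ 2)) ∧
      (∀ α β r, |q α r - q β r| ≤
        lipBound lam s lamInf * (2 * |α - β|) * Real.exp (lipBound lam s lamInf * r ^ 2)) :=
  exists_isRadialProfile n h.continuous_radialNonlin h.lipBound_pos
    (fun r z y => h.abs_satNonlin_sub_le (abs_nonneg r) z y) (fun r => satNonlin_zero _ _)
    (fun r z => by simp [radialNonlin])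

end Coefficients

/-- The energy `u'² / 2 + G(r, u)` of a radial profile. -/
noncomputable def energy (lam s u q : ℝ → ℝ) (r : ℝ) : ℝ :=
  (r * q r) ^ 2 / 2 + satPrim (lam r) (s r) (u r)

theorem radialNonlin_of_nonneg {r : ℝ} (hr : 0 ≤ r) (z : ℝ) :
    radialNonlin lam s r z = satNonlin (lam r) (s r) z := by
  rw [radialNonlin, abs_of_nonneg hr]

section Profile

/-- The terms `± g u'` cancel; the friction and the explicit `r`-dependence of `G` remain, and both
are nonpositive. -/
theorem hasDerivAt_energy (h : Coefficients lam s lamInf sInf)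
    (hp : IsRadialProfile n (radialNonlin lam s) α u q) {r : ℝ} (hr : 0 < r) :
    HasDerivAt (energy lam s u q) (-(n * r * q r ^ 2) + primRadialDeriv lam s r (u r)) r := by
  refine ((((hp.hasDerivAt_mul_q r).pow 2).div_const 2).add
    (h.hasDerivAt_satPrim_comp hr (hp.hasDerivAt_u r))).congr_deriv ?_
  rw [radialNonlin_of_nonneg hr.le]
  push_cast
  ring

/-- The derivative formula holds only for `r > 0`; continuity carries the monotonicity down to the
initial value at `0`. -/
theorem continuousOn_energy (h : Coefficients lam s lamInf sInf)
    (hp : IsRadialProfile n (radialNonlin lam s) α u q) :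
    ContinuousOn (energy lam s u q) (Ici 0) := by
  have hl := h.contDiffOn_lam.continuousOn
  have hs := h.contDiffOn_s.continuousOn
  have hu := hp.continuous_u.continuousOn (s := Ici (0 : ℝ))
  have hq := hp.continuous_q.continuousOn (s := Ici (0 : ℝ))
  have h1 : ContinuousOn (fun r => satPrim (lam r) (s r) (u r)) (Ici 0) := by
    have : ContinuousOn (fun r => -lam r * u r ^ 2 / 2 + Real.log (1 + u r ^ 2 / s r) / 2)
        (Ici 0) := by
      refine ((hl.neg.mul (hu.pow 2)).div_const 2).add (ContinuousOn.div_const (ContinuousOn.log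
        (continuousOn_const.add ((hu.pow 2).div hs fun r hr => (h.s_pos r hr).ne')) ?_) 2)
      intro r hr
      have := h.s_pos r hr
      have : 0 < 1 + u r ^ 2 / s r := by positivity
      exact this.ne'
    exact this.congr fun r hr => satPrim_eq (h.s_pos r hr) _
  exact (((continuousOn_id.mul hq).pow 2).div_const 2).add h1

theorem antitoneOn_energy (h : Coefficients lam s lamInf sInf)
    (hp : IsRadialProfile n (radialNonlin lam s) α u q) :
    AntitoneOn (energy lam s u q) (Ici 0) := by
  refine antitoneOn_of_deriv_nonpos (convex_Ici 0) (continuousOn_energy h hp) ?_ ?_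
  · intro r hr
    rw [interior_Ici] at hr
    exact (hasDerivAt_energy h hp hr).differentiableAt.differentiableWithinAt
  · intro r hr
    rw [interior_Ici] at hr
    rw [(hasDerivAt_energy h hp hr).deriv]
    have h1 := h.primRadialDeriv_nonpos hr (u r)
    have : 0 < r := hr
    have h2 : 0 ≤ n * r * q r ^ 2 := by positivity
    linarith

theorem energy_zero (hp : IsRadialProfile n (radialNonlin lam s) α u q) :
    energy lam s u q 0 = satPrim (lam 0) (s 0) α := by
  simp [energy, hp.u_zero]

theorem energy_le (h : Coefficients lam s lamInf sInf)
    (hp : IsRadialProfile n (radialNonlin lam s) α u q) {r : ℝ} (hr : 0 ≤ r) :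
    energy lam s u q r ≤ satPrim (lam 0) (s 0) α := by
  rw [← energy_zero hp]
  exact antitoneOn_energy h hp (mem_Ici.2 le_rfl) hr hr

theorem satPrim_inf_add_le_energy (h : Coefficients lam s lamInf sInf) {r : ℝ} (hr : 0 ≤ r) :
    (r * q r) ^ 2 / 2 + satPrim lamInf sInf (u r) ≤ energy lam s u q r := by
  have := h.satPrim_inf_le hr (u r)
  unfold energy
  linarith

theorem exists_gt_mul_lt {c σ M : ℝ} (hM : c * (σ + M ^ 2) < 1) :
    ∃ M' > M, c * (σ + M' ^ 2) < 1 := by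
  have hc : Continuous fun x : ℝ => c * (σ + x ^ 2) := by fun_prop
  have h1 := hc.continuousAt.eventually_lt continuousAt_const hM
  have h2 : ∀ᶠ x in 𝓝[>] M, x ∈ Ioi M := self_mem_nhdsWithin
  exact (h2.and (h1.filter_mono nhdsWithin_le_nhds)).exists

/-- Energy confines the profile. -/
theorem Confines.abs_le (h : Coefficients lam s lamInf sInf)
    (hp : IsRadialProfile n (radialNonlin lam s) α u q)
    (hM : Confines lam s lamInf sInf α M) (r : ℝ) : |u r| ≤ M := by
  wlog hr : 0 ≤ r generalizing r
  · have := this (-r) (by linarith)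
    rwa [hp.even_u] at this
  by_contra! hlt
  -- Room above `M` is needed: a profile exceeding `M` attains the level `min M' |u r|`, where `G_∞`
  -- is still increasing and hence larger than the available energy.
  obtain ⟨M', hM', hlt'⟩ := exists_gt_mul_lt hM.mul_lt
  have h0 : |u 0| ≤ M := by rw [hp.u_zero]; exact hM.abs_alpha_le
  have hm : M < min M' |u r| := lt_min hM' hlt
  obtain ⟨t, ht, htm⟩ := intermediate_value_Icc hr (hp.continuous_u.abs.continuousOn)
    (show min M' |u r| ∈ Icc |u 0| |u r| from ⟨h0.trans hm.le, min_le_right _ _⟩)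
  have h1 := satPrim_strictMonoOn h.sInf_pos hlt' ⟨hM.pos.le, hM'.le⟩
    ⟨hM.pos.le.trans hm.le, min_le_left _ _⟩ hm
  rw [← htm, satPrim_abs h.sInf_pos] at h1
  have h2 := satPrim_inf_add_le_energy (u := u) (q := q) h ht.1
  have h3 := energy_le h hp ht.1
  have := hM.prim_le
  nlinarith [sq_nonneg (t * q t)]

theorem kappa_le_energy (h : Coefficients lam s lamInf sInf)
    (hp : IsRadialProfile n (radialNonlin lam s) α u q)
    (hM : Confines lam s lamInf sInf α M) {r : ℝ} (hr : 0 ≤ r) :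
    (r * q r) ^ 2 / 2 + (1 / (sInf + M ^ 2) - lamInf) * u r ^ 2 / 2 ≤ energy lam s u q r := by
  have := satPrim_inf_add_le_energy (u := u) (q := q) h hr
  have := h.kappa_satPrim_inf_le (Confines.abs_le h hp hM r)
  linarith

theorem abs_mul_q_le (h : Coefficients lam s lamInf sInf)
    (hp : IsRadialProfile n (radialNonlin lam s) α u q)
    (hM : Confines lam s lamInf sInf α M) (r : ℝ) :
    |r * q r| ≤ √(2 * satPrim (lam 0) (s 0) α) := by
  wlog hr : 0 ≤ r generalizing r
  · have := this (-r) (by linarith)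
    rwa [hp.even_q, neg_mul, abs_neg] at this
  apply Real.abs_le_sqrt
  have h1 := kappa_le_energy h hp hM hr
  have h2 := energy_le h hp hr
  have := mul_nonneg (h.kappa_pos hM.mul_lt).le (sq_nonneg (u r))
  linarith

end Profile

end SaturableHelmholtz

/-! ### Part: two-sided control of `rⁿ (u² + u'²)`. -/

namespace SaturableHelmholtz

/-- A Gronwall estimate in both directions: `F exp (-Q)` is nonincreasing and `F exp Q` is
nondecreasing. Only a bound on the antiderivative `Q` enters, not one on `Q'`. -/
theorem two_sided_bound_of_abs_deriv_le {F F' Q Q' : ℝ → ℝ} {R B : ℝ}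
    (hF : ∀ r, R ≤ r → HasDerivAt F (F' r) r) (hQ : ∀ r, R ≤ r → HasDerivAt Q (Q' r) r)
    (hle : ∀ r, R ≤ r → |F' r| ≤ Q' r * F r) (hB : ∀ r, R ≤ r → |Q r| ≤ B)
    (h0 : ∀ r, R ≤ r → 0 ≤ F r) {r : ℝ} (hr : R ≤ r) :
    F r ≤ Real.exp (2 * B) * F R ∧ F R ≤ Real.exp (2 * B) * F r := by
  -- The values `σ = 1` and `σ = -1` give the two monotonicity statements together.
  have hm : ∀ σ : ℝ, |σ| = 1 → MonotoneOn (fun r => σ * F r * Real.exp (σ * Q r)) (Ici R) := by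
    intro σ hσ
    have hd : ∀ r, R ≤ r → HasDerivAt (fun r => σ * F r * Real.exp (σ * Q r))
        ((σ * F' r + σ * σ * (Q' r * F r)) * Real.exp (σ * Q r)) r := fun r hr =>
      (((hF r hr).const_mul σ).mul ((hQ r hr).const_mul σ).exp).congr_deriv (by ring)
    refine monotoneOn_of_deriv_nonneg (convex_Ici R)
      (fun r hr => (hd r hr).continuousAt.continuousWithinAt) ?_ ?_
    · intro r hr
      rw [interior_Ici] at hr
      exact (hd r (le_of_lt hr)).differentiableAt.differentiableWithinAt
    · intro r hr
      rw [interior_Ici] at hr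
      rw [(hd r (le_of_lt hr)).deriv]
      refine mul_nonneg ?_ (Real.exp_pos _).le
      have h1 := hle r (le_of_lt hr)
      have h2 : |σ * F' r| = |F' r| := by rw [abs_mul, hσ, one_mul]
      have h3 : σ * σ = 1 := by rw [← abs_mul_abs_self, hσ, one_mul]
      rw [h3, one_mul]
      linarith [neg_abs_le (σ * F' r)]
  have hb1 := abs_le.1 (hB r hr)
  have hb2 := abs_le.1 (hB R le_rfl)
  have h1 := hm 1 (by simp) (mem_Ici.2 le_rfl) hr hr
  have h2 := hm (-1) (by simp) (mem_Ici.2 le_rfl) hr hr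
  simp only [one_mul, neg_mul, neg_le_neg_iff] at h1 h2
  constructor
  · calc F r = F r * Real.exp (-Q r) * Real.exp (Q r) := by
          rw [mul_assoc, ← Real.exp_add]; simp
      _ ≤ F R * Real.exp (-Q R) * Real.exp (Q r) := by gcongr
      _ = Real.exp (Q r - Q R) * F R := by
          rw [mul_assoc, ← Real.exp_add, mul_comm]; ring_nf
      _ ≤ _ := by
          have := h0 R le_rfl
          gcongr; linarith
  · calc F R = F R * Real.exp (Q R) * Real.exp (-Q R) := by
          rw [mul_assoc, ← Real.exp_add]; simp
      _ ≤ F r * Real.exp (Q r) * Real.exp (-Q R) := by gcongr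
      _ = Real.exp (Q r - Q R) * F r := by
          rw [mul_assoc, ← Real.exp_add, mul_comm]; ring_nf
      _ ≤ _ := by
          have := h0 r hr
          gcongr; linarith

/-- The squared size `u² + u'²` of a radial profile. -/
def sizeSq (u q : ℝ → ℝ) (r : ℝ) : ℝ := u r ^ 2 + (r * q r) ^ 2

theorem sizeSq_nonneg (u q : ℝ → ℝ) (r : ℝ) : 0 ≤ sizeSq u q r := by
  unfold sizeSq; positivity

variable {lam s : ℝ → ℝ} {lamInf sInf : ℝ} {n : ℕ} {α M k : ℝ} {u q : ℝ → ℝ}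

/-- A profile whose energy controls its size with constant `k ∈ (0, 1]`. -/
structure IsCoerciveProfile (lam s : ℝ → ℝ) (lamInf sInf : ℝ) (n : ℕ) (α M k : ℝ)
    (u q : ℝ → ℝ) : Prop where
  coeff : Coefficients lam s lamInf sInf
  profile : IsRadialProfile n (radialNonlin lam s) α u q
  confines : Confines lam s lamInf sInf α M
  one_le_n : 1 ≤ n
  k_pos : 0 < k
  k_le_one : k ≤ 1
  k_le_kappa : k ≤ 1 / (sInf + M ^ 2) - lamInf

namespace IsCoerciveProfile

theorem one_le_cast (h : IsCoerciveProfile lam s lamInf sInf n α M k u q) : (1 : ℝ) ≤ n := by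
  exact_mod_cast h.one_le_n

theorem radius_pos (h : IsCoerciveProfile lam s lamInf sInf n α M k u q) :
    0 < ((n : ℝ) + 1) / k := by
  have := h.k_pos
  positivity

theorem one_le_radius (h : IsCoerciveProfile lam s lamInf sInf n α M k u q) :
    1 ≤ ((n : ℝ) + 1) / k := by
  rw [one_le_div h.k_pos]
  linarith [h.k_le_one, h.one_le_cast]

theorem k_mul_le (h : IsCoerciveProfile lam s lamInf sInf n α M k u q) {r : ℝ} (hr : 0 ≤ r) :
    k * u r ^ 2 ≤ satNonlin (lam r) (s r) (u r) * u r := by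
  have h1 := h.coeff.le_satNonlin_inf_mul (Confines.abs_le h.coeff h.profile h.confines r)
  have h2 := h.coeff.satNonlin_inf_mul_le hr (u r)
  have := mul_le_mul_of_nonneg_right h.k_le_kappa (sq_nonneg (u r))
  linarith

theorem k_sizeSq_le_energy (h : IsCoerciveProfile lam s lamInf sInf n α M k u q) {r : ℝ}
    (hr : 0 ≤ r) : k / 2 * sizeSq u q r ≤ energy lam s u q r := by
  have h1 := kappa_le_energy h.coeff h.profile h.confines hr
  have h2 := mul_le_mul_of_nonneg_right h.k_le_kappa (sq_nonneg (u r))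
  have h3 := mul_le_mul_of_nonneg_right h.k_le_one (sq_nonneg (r * q r))
  unfold sizeSq
  linarith

theorem energy_le_sizeSq (h : IsCoerciveProfile lam s lamInf sInf n α M k u q) {r : ℝ}
    (hr : 0 ≤ r) : energy lam s u q r ≤ (1 + lipBound lam s lamInf) / 2 * sizeSq u q r := by
  have h1 := satPrim_le (l := lam r) (h.coeff.s_pos r hr) (u r)
  have h2 := mul_le_mul_of_nonneg_right (h.coeff.one_div_s_sub_lam_le hr) (sq_nonneg (u r))
  have h3 := mul_nonneg h.coeff.lipBound_pos.le (sq_nonneg (r * q r))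
  have h4 := sq_nonneg (u r)
  unfold energy sizeSq
  linarith

/-- Since `r |u q| = |u u'| ≤ (u² + u'²) / 2`, cross terms are absorbed once `n + 1 ≤ k r`. This
fixes the threshold radius `(n + 1) / k` used throughout. -/
theorem mul_abs_le_sizeSq (h : IsCoerciveProfile lam s lamInf sInf n α M k u q) {r : ℝ}
    (hr : ((n : ℝ) + 1) / k ≤ r) : (n + 1) * |u r * q r| ≤ k / 2 * sizeSq u q r := by
  have hk := h.k_pos
  have h0 : 0 < r := h.radius_pos.trans_le hr
  rw [div_le_iff₀ hk] at hr
  have h1 : r * |u r * q r| ≤ sizeSq u q r / 2 := by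
    rw [← abs_of_pos h0, ← abs_mul, abs_of_pos h0]
    have e : r * (u r * q r) = u r * (r * q r) := by ring
    rw [e, _root_.abs_le]
    unfold sizeSq
    constructor <;> nlinarith [sq_nonneg (u r + r * q r), sq_nonneg (u r - r * q r)]
  calc (n + 1) * |u r * q r| ≤ r * k * |u r * q r| := by gcongr
    _ = k * (r * |u r * q r|) := by ring
    _ ≤ k * (sizeSq u q r / 2) := by gcongr
    _ = _ := by ring

theorem hasDerivAt_mul (h : IsCoerciveProfile lam s lamInf sInf n α M k u q) {r : ℝ}
    (hr : 0 < r) : HasDerivAt (fun r => u r * q r)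
      (r * q r ^ 2 - (satNonlin (lam r) (s r) (u r) * u r + (n + 1) * (u r * q r)) / r) r := by
  refine ((h.profile.hasDerivAt_u r).mul (h.profile.hasDerivAt_q r hr.ne')).congr_deriv ?_
  rw [radialNonlin_of_nonneg hr.le]
  field_simp
  ring

/-- An energy that is dissipated at a rate comparable to `(u² + u'²) / r`. -/
noncomputable def dissipatedEnergy (lam s u q : ℝ → ℝ) (r : ℝ) : ℝ :=
  energy lam s u q r + 1 / 2 * (u r * q r)

/-- Friction alone dissipates only `u'²`. The derivative of `u q` contributes `-g u / r ≤ -k u² /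
r`, and the `u'² / r` it adds with weight `1 / 2` is at most half of the friction because `n ≥ 1`.
Half of the resulting `k / 2` is spent on the cross term, leaving `k / 4`. -/
theorem exists_hasDerivAt_dissipatedEnergy
    (h : IsCoerciveProfile lam s lamInf sInf n α M k u q) {r : ℝ}
    (hr : ((n : ℝ) + 1) / k ≤ r) :
    ∃ D', HasDerivAt (dissipatedEnergy lam s u q) D' r ∧ D' ≤ -(k / 4 * sizeSq u q r / r) := by
  have h0 : 0 < r := h.radius_pos.trans_le hr
  refine ⟨_, (hasDerivAt_energy h.coeff h.profile h0).add ((h.hasDerivAt_mul h0).const_mul (1 / 2)),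
    ?_⟩
  have h1 := h.coeff.primRadialDeriv_nonpos h0 (u r)
  have h2 := h.mul_abs_le_sizeSq hr
  have h3 := h.k_mul_le h0.le
  have h4 := mul_le_mul_of_nonneg_right h.one_le_cast (sq_nonneg (r * q r))
  have h5 := mul_le_mul_of_nonneg_right h.k_le_one (sq_nonneg (r * q r))
  have h6 : -((n + 1) * |u r * q r|) ≤ (n + 1) * (u r * q r) := by
    rw [← mul_neg]
    gcongr
    exact neg_abs_le _
  have h7 : -(n * r * q r ^ 2) + 1 / 2 * (r * q r ^ 2 - (satNonlin (lam r) (s r) (u r) * u r +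
      (n + 1) * (u r * q r)) / r) = (-(n * (r * q r) ^ 2) + 1 / 2 * (r * q r) ^ 2 -
      1 / 2 * (satNonlin (lam r) (s r) (u r) * u r + (n + 1) * (u r * q r))) / r := by
    field_simp
    ring
  have h8 : -(n * (r * q r) ^ 2) + 1 / 2 * (r * q r) ^ 2 -
      1 / 2 * (satNonlin (lam r) (s r) (u r) * u r + (n + 1) * (u r * q r)) ≤
      -(k / 4 * sizeSq u q r) := by
    unfold sizeSq at *
    linarith
  have h9 := div_le_div_of_nonneg_right h8 h0.le
  rw [← h7, neg_div] at h9
  linarith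

theorem dissipatedEnergy_nonneg (h : IsCoerciveProfile lam s lamInf sInf n α M k u q) {r : ℝ}
    (hr : ((n : ℝ) + 1) / k ≤ r) : 0 ≤ dissipatedEnergy lam s u q r := by
  have h1 := h.k_sizeSq_le_energy (h.radius_pos.trans_le hr).le
  have h2 := h.mul_abs_le_sizeSq hr
  have h3 : |u r * q r| ≤ (n + 1) * |u r * q r| :=
    le_mul_of_one_le_left (abs_nonneg _) (by linarith [h.one_le_cast])
  have := neg_abs_le (u r * q r)
  have := mul_nonneg h.k_pos.le (sizeSq_nonneg u q r)
  unfold dissipatedEnergy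
  linarith

theorem antitoneOn_dissipatedEnergy (h : IsCoerciveProfile lam s lamInf sInf n α M k u q) :
    AntitoneOn (dissipatedEnergy lam s u q) (Ici (((n : ℝ) + 1) / k)) := by
  refine antitoneOn_of_deriv_nonpos (convex_Ici _) ?_ ?_ ?_
  · intro r hr
    obtain ⟨_, hd, -⟩ := h.exists_hasDerivAt_dissipatedEnergy hr
    exact hd.continuousAt.continuousWithinAt
  · intro r hr
    obtain ⟨_, hd, -⟩ := h.exists_hasDerivAt_dissipatedEnergy (interior_subset hr)
    exact hd.differentiableAt.differentiableWithinAt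
  · intro r hr
    obtain ⟨_, hd, hle⟩ := h.exists_hasDerivAt_dissipatedEnergy (interior_subset hr)
    rw [hd.deriv]
    refine hle.trans (neg_nonpos.2 ?_)
    have := h.k_pos
    have := sizeSq_nonneg u q r
    have := h.radius_pos.trans_le (interior_subset hr : ((n : ℝ) + 1) / k ≤ r)
    positivity

/-- The energy rescaled by the expected decay rate. -/
noncomputable def scaledEnergy (n : ℕ) (lam s u q : ℝ → ℝ) (r : ℝ) : ℝ :=
  r ^ n * (energy lam s u q r + n / 2 * (u r * q r))

theorem scaledEnergy_bounds (h : IsCoerciveProfile lam s lamInf sInf n α M k u q) {r : ℝ}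
    (hr : ((n : ℝ) + 1) / k ≤ r) :
    k / 4 * (r ^ n * sizeSq u q r) ≤ scaledEnergy n lam s u q r ∧
      scaledEnergy n lam s u q r ≤ (1 + lipBound lam s lamInf) * (r ^ n * sizeSq u q r) := by
  have h0 : 0 < r := h.radius_pos.trans_le hr
  have h1 := h.k_sizeSq_le_energy h0.le
  have h2 := h.mul_abs_le_sizeSq hr
  have h3 := h.energy_le_sizeSq h0.le
  have h4 : n * |u r * q r| ≤ (n + 1) * |u r * q r| := by gcongr; linarith
  have h5 : |n * (u r * q r)| = n * |u r * q r| := by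
    rw [abs_mul, abs_of_nonneg (Nat.cast_nonneg n)]
  have h6 := abs_le.1 (h5.trans_le (h4.trans h2))
  have hP := sizeSq_nonneg u q r
  have h7 := mul_le_mul_of_nonneg_right h.k_le_one hP
  have h8 := mul_nonneg h.coeff.lipBound_pos.le hP
  unfold scaledEnergy
  constructor
  · rw [mul_left_comm]
    gcongr
    linarith [h6.1]
  · rw [mul_left_comm (1 + lipBound lam s lamInf)]
    gcongr
    linarith [h6.2]

/-- The derivative of `scaledEnergy` along solutions. -/
noncomputable def scaledEnergyDeriv (n : ℕ) (lam s u q : ℝ → ℝ) (r : ℝ) : ℝ :=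
  r ^ n * (n / r * (satPrim (lam r) (s r) (u r) - satNonlin (lam r) (s r) (u r) * u r / 2) +
        primRadialDeriv lam s r (u r) - n / (2 * r) * (u r * q r))

/-- The weight `n / 2` is the one for which all `u'²` terms cancel and the potential terms combine
into `G - g u / 2`, which is quartic in `u`. -/
theorem hasDerivAt_scaledEnergy (h : IsCoerciveProfile lam s lamInf sInf n α M k u q) {r : ℝ}
    (hr : 0 < r) : HasDerivAt (scaledEnergy n lam s u q)
      (scaledEnergyDeriv n lam s u q r) r := by
  refine ((hasDerivAt_pow n r).mul ((hasDerivAt_energy h.coeff h.profile hr).add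
    ((h.hasDerivAt_mul hr).const_mul ((n : ℝ) / 2)))).congr_deriv ?_
  have e : r ^ n = r ^ (n - 1) * r := by
    rw [← pow_succ, Nat.sub_add_cancel h.one_le_n]
  simp only [Pi.add_apply]
  rw [e, energy, scaledEnergyDeriv, e]
  field_simp
  ring

theorem abs_deriv_scaledEnergy_le (h : IsCoerciveProfile lam s lamInf sInf n α M k u q) {r : ℝ}
    (hr : 1 ≤ r) :
    |scaledEnergyDeriv n lam s u q r| ≤
      r ^ n * sizeSq u q r * (n / (2 * s 0 ^ 2) * (sizeSq u q r / r) +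
        (1 + 1 / s 0 ^ 2) * (deriv lam r + deriv s r) + n * (1 / r ^ 2)) := by
  have h0 : 0 < r := by linarith
  have hs0 := h.coeff.s_zero_pos
  have hP := sizeSq_nonneg u q r
  have hu : u r ^ 2 ≤ sizeSq u q r := le_add_of_nonneg_right (sq_nonneg _)
  rw [scaledEnergyDeriv, abs_mul, abs_of_pos (pow_pos h0 n), mul_assoc]
  gcongr
  have h1 := half_satNonlin_mul_le_satPrim (l := lam r) (h.coeff.s_pos r h0.le) (u r)
  have h2 := satPrim_sub_half_le (l := lam r) (h.coeff.s_pos r h0.le) (u r)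
  have h3 := h.coeff.primRadialDeriv_nonpos h0 (u r)
  have h4 := h.coeff.neg_primRadialDeriv_le h0 (u r)
  have h5 : u r ^ 4 / (2 * s r ^ 2) ≤ sizeSq u q r ^ 2 / (2 * s 0 ^ 2) := by
    have := h.coeff.le_s h0.le
    have e : u r ^ 4 = (u r ^ 2) ^ 2 := by ring
    rw [e]
    gcongr
  have h6 : (1 + 1 / s 0 ^ 2) * (deriv lam r + deriv s r) * u r ^ 2 ≤
      (1 + 1 / s 0 ^ 2) * (deriv lam r + deriv s r) * sizeSq u q r := by
    have := h.coeff.deriv_lam_nonneg h0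
    have := h.coeff.deriv_s_nonneg h0
    gcongr
  have h7 : |n / (2 * r) * (u r * q r)| ≤ n * (1 / r ^ 2) * sizeSq u q r := by
    have e : n / (2 * r) * (u r * q r) = n * (1 / r ^ 2) * (u r * (r * q r) / 2) := by
      field_simp
    rw [e, abs_mul, abs_of_nonneg (by positivity : (0 : ℝ) ≤ n * (1 / r ^ 2))]
    gcongr
    unfold sizeSq
    rw [_root_.abs_le]
    constructor <;> nlinarith [sq_nonneg (u r + r * q r), sq_nonneg (u r - r * q r)]
  have h8 : n / r * (satPrim (lam r) (s r) (u r) - satNonlin (lam r) (s r) (u r) * u r / 2) ≤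
      n / r * (sizeSq u q r ^ 2 / (2 * s 0 ^ 2)) := by
    gcongr
    exact h2.trans h5
  have h9 : 0 ≤ n / r * (satPrim (lam r) (s r) (u r) - satNonlin (lam r) (s r) (u r) * u r / 2) :=
    mul_nonneg (by positivity) (by linarith)
  have h10 : sizeSq u q r * (n / (2 * s 0 ^ 2) * (sizeSq u q r / r)) =
      n / r * (sizeSq u q r ^ 2 / (2 * s 0 ^ 2)) := by
    field_simp
  have h11 := abs_le.1 h7
  rw [mul_add, mul_add, h10, _root_.abs_le]
  constructor
  · linarith [h11.2]
  · have : 0 ≤ n / r * (sizeSq u q r ^ 2 / (2 * s 0 ^ 2)) := by positivity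
    linarith [h11.1]

/-- For large radii the quantity `rⁿ (u² + u'²)` stays comparable to its value at a fixed radius. -/
theorem exists_comparable (h : IsCoerciveProfile lam s lamInf sInf n α M k u q) :
    ∃ c C : ℝ, 0 < c ∧ 0 < C ∧ ∀ r, ((n : ℝ) + 1) / k ≤ r →
      r ^ n * sizeSq u q r ≤ C * sizeSq u q (((n : ℝ) + 1) / k) ∧
      c * sizeSq u q (((n : ℝ) + 1) / k) ≤ r ^ n * sizeSq u q r := by
  set R := ((n : ℝ) + 1) / k with hR
  have hR0 : 0 < R := h.radius_pos
  have hk := h.k_pos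
  have hs0 := h.coeff.s_zero_pos
  have hK := h.coeff.lipBound_pos
  set A : ℝ := n / (2 * s 0 ^ 2) with hA
  set L : ℝ := 1 + 1 / s 0 ^ 2 with hL
  have hA0 : 0 ≤ A := by positivity
  have hL0 : 0 < L := by positivity
  -- An antiderivative of the logarithmic growth bound: the dissipated energy accounts for `P / r`,
  -- `lam + s` for `lam' + s'`, and `-1 / r` for `1 / r²`. Each piece is bounded.
  let Q : ℝ → ℝ := fun r =>
    4 / k * (-(4 * A / k) * dissipatedEnergy lam s u q r + L * (lam r + s r) + n * (-r⁻¹))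
  choose! D' hD' hDle using fun r (hr : R ≤ r) => h.exists_hasDerivAt_dissipatedEnergy hr
  have hQ : ∀ r, R ≤ r → HasDerivAt Q (4 / k * (-(4 * A / k) * D' r +
      L * (deriv lam r + deriv s r) + n * (1 / r ^ 2))) r := by
    intro r hr
    have h0 : 0 < r := hR0.trans_le hr
    refine (((((hD' r hr).const_mul (-(4 * A / k))).add
      (((hasDerivAt_of_contDiffOn_Ici h.coeff.contDiffOn_lam h0).add
        (hasDerivAt_of_contDiffOn_Ici h.coeff.contDiffOn_s h0)).const_mul L)).add
      ((hasDerivAt_inv h0.ne').neg.const_mul (n : ℝ))).const_mul (4 / k)).congr_deriv ?_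
    rw [neg_neg, one_div]
  have hle : ∀ r, R ≤ r → |scaledEnergyDeriv n lam s u q r| ≤ (4 / k * (-(4 * A / k) * D' r +
      L * (deriv lam r + deriv s r) + n * (1 / r ^ 2))) * scaledEnergy n lam s u q r := by
    intro r hr
    have h0 : 0 < r := hR0.trans_le hr
    refine (h.abs_deriv_scaledEnergy_le (h.one_le_radius.trans hr)).trans ?_
    have h1 := (h.scaledEnergy_bounds hr).1
    have h2 : r ^ n * sizeSq u q r ≤ 4 / k * scaledEnergy n lam s u q r := by
      calc r ^ n * sizeSq u q r = 4 / k * (k / 4 * (r ^ n * sizeSq u q r)) := by field_simp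
        _ ≤ _ := by gcongr
    have h3 : A * (sizeSq u q r / r) ≤ -(4 * A / k) * D' r := by
      calc A * (sizeSq u q r / r) = 4 * A / k * (k / 4 * sizeSq u q r / r) := by field_simp
        _ ≤ 4 * A / k * (-D' r) := by
            gcongr
            linarith [hDle r hr]
        _ = _ := by ring
    have hP := sizeSq_nonneg u q r
    have h4 := h.coeff.deriv_lam_nonneg h0
    have h5 := h.coeff.deriv_s_nonneg h0
    calc _ ≤ r ^ n * sizeSq u q r *
          (-(4 * A / k) * D' r + L * (deriv lam r + deriv s r) + n * (1 / r ^ 2)) := by gcongr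
      _ ≤ 4 / k * scaledEnergy n lam s u q r *
          (-(4 * A / k) * D' r + L * (deriv lam r + deriv s r) + n * (1 / r ^ 2)) := by
          have : 0 ≤ A * (sizeSq u q r / r) := by positivity
          have : 0 ≤ L * (deriv lam r + deriv s r) := by positivity
          have : 0 ≤ n * (1 / r ^ 2) := by positivity
          refine mul_le_mul_of_nonneg_right h2 (by linarith)
      _ = _ := by ring
  let B := 4 / k * (4 * A / k * dissipatedEnergy lam s u q R +
    L * (|lam 0| + |lamInf| + sInf) + n)
  have hB : ∀ r, R ≤ r → |Q r| ≤ B := by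
    intro r hr
    have h0 : 0 < r := hR0.trans_le hr
    have h1 : 1 ≤ r := h.one_le_radius.trans hr
    have hd1 := h.dissipatedEnergy_nonneg hr
    have hd2 := h.antitoneOn_dissipatedEnergy (mem_Ici.2 le_rfl) (mem_Ici.2 hr) hr
    simp only [Q, B]
    rw [abs_mul, abs_of_pos (by positivity : 0 < 4 / k)]
    gcongr
    refine (abs_add_three _ _ _).trans ?_
    gcongr
    · rw [abs_mul, abs_neg, abs_of_nonneg (by positivity : 0 ≤ 4 * A / k), abs_of_nonneg hd1]
      gcongr
    · rw [abs_mul, abs_of_pos hL0]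
      gcongr
      refine (abs_add_le _ _).trans (add_le_add (h.coeff.abs_lam_le h0.le) ?_)
      rw [abs_of_pos (h.coeff.s_pos r h0.le)]
      exact h.coeff.s_le h0.le
    · rw [abs_mul, abs_neg, abs_of_nonneg (Nat.cast_nonneg n), abs_of_pos (inv_pos.2 h0)]
      exact mul_le_of_le_one_right (Nat.cast_nonneg n) (inv_le_one_of_one_le₀ h1)
  have hF0 : ∀ r, R ≤ r → 0 ≤ scaledEnergy n lam s u q r := by
    intro r hr
    have h0 : 0 < r := hR0.trans_le hr
    have hP := sizeSq_nonneg u q r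
    exact le_trans (by positivity) (h.scaledEnergy_bounds hr).1
  refine ⟨(k / 4 * R ^ n) / (Real.exp (2 * B) * (1 + lipBound lam s lamInf)),
    Real.exp (2 * B) * (1 + lipBound lam s lamInf) * R ^ n / (k / 4), by positivity, by positivity,
    fun r hr => ?_⟩
  obtain ⟨h1, h2⟩ := two_sided_bound_of_abs_deriv_le
    (fun r hr => h.hasDerivAt_scaledEnergy (hR0.trans_le hr)) hQ hle hB hF0 hr
  obtain ⟨h3, h4⟩ := h.scaledEnergy_bounds hr
  obtain ⟨h5, h6⟩ := h.scaledEnergy_bounds (le_refl R)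
  constructor
  · have : k / 4 * (r ^ n * sizeSq u q r) ≤
        Real.exp (2 * B) * ((1 + lipBound lam s lamInf) * (R ^ n * sizeSq u q R)) := by
      refine h3.trans (h1.trans ?_)
      gcongr
    rw [div_mul_eq_mul_div, le_div_iff₀ (by positivity)]
    linarith
  · have : k / 4 * (R ^ n * sizeSq u q R) ≤
        Real.exp (2 * B) * ((1 + lipBound lam s lamInf) * (r ^ n * sizeSq u q r)) := by
      refine h5.trans (h2.trans ?_)
      gcongr
    rw [div_mul_eq_mul_div, div_le_iff₀ (by positivity)]
    linarith

end IsCoerciveProfile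

end SaturableHelmholtz

/-! ### Part: nontriviality, decay rates and oscillation. -/

namespace SaturableHelmholtz

variable {lam s : ℝ → ℝ} {lamInf sInf : ℝ} {n : ℕ} {α M k : ℝ} {u q : ℝ → ℝ}

theorem continuous_sizeSq (hu : Continuous u) (hq : Continuous q) : Continuous (sizeSq u q) := by
  unfold sizeSq
  fun_prop

namespace IsCoerciveProfile

theorem abs_radialNonlin_le (h : IsCoerciveProfile lam s lamInf sInf n α M k u q) (r : ℝ) :
    |radialNonlin lam s r (u r)| ≤ lipBound lam s lamInf * |u r| :=
  h.coeff.abs_satNonlin_le (abs_nonneg r) (u r)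

/-- Backward uniqueness: `u² + u'²` decays at most exponentially away from the origin. The
comparison starts at some `ε > 0` with `u ε ≠ 0`, since the friction coefficient `n / t` is
unbounded near `0`. -/
theorem sizeSq_pos (h : IsCoerciveProfile lam s lamInf sInf n α M k u q) (hα : α ≠ 0) {r : ℝ}
    (hr : 0 < r) : 0 < sizeSq u q r := by
  have hK := h.coeff.lipBound_pos
  have h0 : u 0 ≠ 0 := by rwa [h.profile.u_zero]
  obtain ⟨ε, hε, hεr, huε⟩ : ∃ ε, 0 < ε ∧ ε < r ∧ u ε ≠ 0 := by
    have h1 : ∀ᶠ x in 𝓝[>] (0 : ℝ), u x ≠ 0 :=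
      (h.profile.continuous_u.continuousAt.eventually_ne h0).filter_mono nhdsWithin_le_nhds
    have h2 : ∀ᶠ x in 𝓝[>] (0 : ℝ), x ∈ Ioo 0 r := Ioo_mem_nhdsGT hr
    obtain ⟨x, hx, hx'⟩ := (h1.and h2).exists
    exact ⟨x, hx'.1, hx'.2, hx⟩
  -- The three summands dominate the losses from `2 u u'`, from the nonlinearity and from the
  -- friction on `[ε, ∞)`.
  set C : ℝ := 1 + lipBound lam s lamInf + 2 * n / ε
  have hd : ∀ t, HasDerivAt (fun t => sizeSq u q t * Real.exp (C * t))
      ((2 * u t * (t * q t) + 2 * (t * q t) * (-radialNonlin lam s t (u t) - n * q t) +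
        C * sizeSq u q t) * Real.exp (C * t)) t := by
    intro t
    have h1 := ((h.profile.hasDerivAt_u t).pow 2).add ((h.profile.hasDerivAt_mul_q t).pow 2)
    refine (h1.mul (((hasDerivAt_id t).const_mul C).exp)).congr_deriv ?_
    simp only [Pi.add_apply, Pi.pow_apply, id, sizeSq]
    push_cast
    ring
  have hm : MonotoneOn (fun t => sizeSq u q t * Real.exp (C * t)) (Ici ε) := by
    refine monotoneOn_of_deriv_nonneg (convex_Ici ε)
      (fun t _ => (hd t).continuousAt.continuousWithinAt)
      (fun t _ => (hd t).differentiableAt.differentiableWithinAt) fun t ht => ?_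
    rw [interior_Ici] at ht
    have ht' : ε < t := ht
    have ht0 : 0 < t := hε.trans ht'
    rw [(hd t).deriv]
    refine mul_nonneg ?_ (Real.exp_pos _).le
    have hg := h.abs_radialNonlin_le t
    have h1 : 2 * (t * q t) * (n * q t) ≤ 2 * n / ε * (t * q t) ^ 2 := by
      calc 2 * (t * q t) * (n * q t) = 2 * n / t * (t * q t) ^ 2 := by field_simp
        _ ≤ 2 * n / ε * (t * q t) ^ 2 := by gcongr
    have h2 : 2 * (t * q t) * radialNonlin lam s t (u t) ≤
        lipBound lam s lamInf * sizeSq u q t := by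
      have h3 : (t * q t) * radialNonlin lam s t (u t) ≤
          |t * q t| * (lipBound lam s lamInf * |u t|) := by
        refine (le_abs_self _).trans ?_
        rw [abs_mul]
        gcongr
      have h4 : 2 * (|t * q t| * |u t|) ≤ sizeSq u q t := by
        unfold sizeSq
        rw [← sq_abs (u t), ← sq_abs (t * q t)]
        nlinarith [sq_nonneg (|u t| - |t * q t|)]
      have := mul_le_mul_of_nonneg_left h4 hK.le
      linarith
    have h5 : -(2 * u t * (t * q t)) ≤ sizeSq u q t := by
      unfold sizeSq
      nlinarith [sq_nonneg (u t + t * q t)]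
    have h6 : 2 * n / ε * (t * q t) ^ 2 ≤ 2 * n / ε * sizeSq u q t := by
      have := le_add_of_nonneg_left (a := (t * q t) ^ 2) (sq_nonneg (u t))
      unfold sizeSq
      gcongr
    simp only [C]
    linarith
  have h1 := hm (mem_Ici.2 le_rfl) (mem_Ici.2 hεr.le) hεr.le
  have h2 : 0 < sizeSq u q ε := by
    unfold sizeSq
    positivity
  have h3 : 0 < sizeSq u q r * Real.exp (C * r) := lt_of_lt_of_le (by positivity) h1
  exact pos_of_mul_pos_left h3 (Real.exp_pos _).le

theorem exists_upper_bound (h : IsCoerciveProfile lam s lamInf sInf n α M k u q) :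
    ∃ C, 0 < C ∧ ∀ r, 1 ≤ r → r ^ n * sizeSq u q r ≤ C := by
  obtain ⟨_, C, -, -, hC⟩ := h.exists_comparable
  have hc : Continuous fun r => r ^ n * sizeSq u q r :=
    (continuous_pow n).mul (continuous_sizeSq h.profile.continuous_u h.profile.continuous_q)
  obtain ⟨B, hB⟩ := (isCompact_Icc (a := (1 : ℝ)) (b := ((n : ℝ) + 1) / k)).bddAbove_image
    hc.continuousOn
  refine ⟨max 1 (max B (C * sizeSq u q (((n : ℝ) + 1) / k))), by positivity, fun r hr => ?_⟩
  rcases le_total r (((n : ℝ) + 1) / k) with hle | hle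
  · exact (hB (mem_image_of_mem _ ⟨hr, hle⟩)).trans ((le_max_left _ _).trans (le_max_right _ _))
  · exact (hC r hle).1.trans ((le_max_right _ _).trans (le_max_right _ _))

theorem exists_lower_bound (h : IsCoerciveProfile lam s lamInf sInf n α M k u q) (hα : α ≠ 0) :
    ∃ c, 0 < c ∧ ∀ r, 1 ≤ r → c ≤ r ^ n * sizeSq u q r := by
  obtain ⟨c, _, hc0, -, hC⟩ := h.exists_comparable
  have hc : Continuous fun r => r ^ n * sizeSq u q r :=
    (continuous_pow n).mul (continuous_sizeSq h.profile.continuous_u h.profile.continuous_q)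
  obtain ⟨x, hx, hmin⟩ := (isCompact_Icc (a := (1 : ℝ)) (b := ((n : ℝ) + 1) / k)).exists_isMinOn
    ⟨1, le_rfl, h.one_le_radius⟩ hc.continuousOn
  have hx0 : 0 < x := by linarith [hx.1]
  have h1 := h.sizeSq_pos hα hx0
  have h2 := h.sizeSq_pos hα h.radius_pos
  refine ⟨min (x ^ n * sizeSq u q x) (c * sizeSq u q (((n : ℝ) + 1) / k)),
    lt_min (by positivity) (by positivity), fun r hr => ?_⟩
  rcases le_total r (((n : ℝ) + 1) / k) with hle | hle
  · exact (min_le_left _ _).trans (hmin ⟨hr, hle⟩)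
  · exact (min_le_right _ _).trans (hC r hle).2

theorem rpow_neg_half_sq (n : ℕ) {r : ℝ} (hr : 0 < r) :
    r ^ n * (r ^ ((1 - ((n + 1 : ℕ) : ℝ)) / 2)) ^ 2 = 1 := by
  rw [← Real.rpow_natCast r n, ← Real.rpow_natCast _ 2, ← Real.rpow_mul hr.le, ← Real.rpow_add hr]
  push_cast
  ring_nf
  exact Real.rpow_zero r

theorem exists_decay (h : IsCoerciveProfile lam s lamInf sInf n α M k u q) :
    ∃ C : ℝ, 0 < C ∧ ∀ r : ℝ, 1 ≤ r →
      |u r| + |deriv u r| + |deriv (deriv u) r| ≤ C * r ^ ((1 - ((n + 1 : ℕ) : ℝ)) / 2) := by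
  obtain ⟨C, hC, hb⟩ := h.exists_upper_bound
  have hK := h.coeff.lipBound_pos
  refine ⟨(1 + lipBound lam s lamInf + n) * √(2 * C), by positivity, fun r hr => ?_⟩
  have h0 : 0 < r := by linarith
  rw [h.profile.deriv_deriv_u, h.profile.deriv_u]
  set y := r ^ ((1 - ((n + 1 : ℕ) : ℝ)) / 2)
  have hy : 0 < y := Real.rpow_pos_of_pos h0 _
  have hy2 : r ^ n * y ^ 2 = 1 := rpow_neg_half_sq n h0
  have h1 : sizeSq u q r ≤ C * y ^ 2 := by
    calc sizeSq u q r = (r ^ n * y ^ 2) * sizeSq u q r := by rw [hy2, one_mul]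
      _ = (r ^ n * sizeSq u q r) * y ^ 2 := by ring
      _ ≤ C * y ^ 2 := by gcongr; exact hb r hr
  have h2 : |u r| + |r * q r| ≤ √(2 * C) * y := by
    refine abs_le_of_sq_le_sq' ?_ (by positivity) |>.2
    rw [mul_pow, Real.sq_sqrt (by positivity)]
    unfold sizeSq at h1
    rw [← sq_abs (u r), ← sq_abs (r * q r)] at h1
    nlinarith [sq_nonneg (|u r| - |r * q r|)]
  have h3 : |-radialNonlin lam s r (u r) - n * q r| ≤
      lipBound lam s lamInf * |u r| + n * |r * q r| := by
    refine (abs_sub _ _).trans ?_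
    rw [abs_neg, abs_mul, abs_of_nonneg (Nat.cast_nonneg (α := ℝ) n)]
    refine add_le_add (h.abs_radialNonlin_le r) (mul_le_mul_of_nonneg_left ?_ (Nat.cast_nonneg n))
    · rw [abs_mul, abs_of_pos h0]
      exact le_mul_of_one_le_left (abs_nonneg _) hr
  calc |u r| + |r * q r| + |-radialNonlin lam s r (u r) - n * q r|
      ≤ (1 + lipBound lam s lamInf + n) * (|u r| + |r * q r|) := by
        have := mul_nonneg hK.le (abs_nonneg (r * q r))
        have := mul_nonneg (Nat.cast_nonneg (α := ℝ) n) (abs_nonneg (u r))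
        linarith
    _ ≤ (1 + lipBound lam s lamInf + n) * (√(2 * C) * y) := by gcongr
    _ = _ := by ring

theorem exists_lower_decay (h : IsCoerciveProfile lam s lamInf sInf n α M k u q) (hα : α ≠ 0) :
    ∃ c : ℝ, 0 < c ∧ ∀ r : ℝ, 1 ≤ r →
      c * r ^ ((1 - ((n + 1 : ℕ) : ℝ)) / 2) ≤ |u r| + |deriv u r| + |deriv (deriv u) r| := by
  obtain ⟨c, hc, hb⟩ := h.exists_lower_bound hα
  refine ⟨√c, by positivity, fun r hr => ?_⟩
  have h0 : 0 < r := by linarith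
  rw [h.profile.deriv_u]
  refine le_trans ?_ (le_add_of_nonneg_right (abs_nonneg _))
  set y := r ^ ((1 - ((n + 1 : ℕ) : ℝ)) / 2)
  have hy2 : r ^ n * y ^ 2 = 1 := rpow_neg_half_sq n h0
  refine abs_le_of_sq_le_sq' ?_ (by positivity) |>.2
  rw [mul_pow, Real.sq_sqrt hc.le]
  calc c * y ^ 2 ≤ r ^ n * sizeSq u q r * y ^ 2 := by gcongr; exact hb r hr
    _ = (r ^ n * y ^ 2) * sizeSq u q r := by ring
    _ = sizeSq u q r := by rw [hy2, one_mul]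
    _ ≤ _ := by
      unfold sizeSq
      rw [← sq_abs (u r), ← sq_abs (r * q r)]
      nlinarith [abs_nonneg (u r), abs_nonneg (r * q r)]

theorem tendsto_sizeSq (h : IsCoerciveProfile lam s lamInf sInf n α M k u q) :
    Tendsto (sizeSq u q) atTop (𝓝 0) := by
  obtain ⟨C, hC, hb⟩ := h.exists_upper_bound
  have h1 : Tendsto (fun r : ℝ => C / r ^ n) atTop (𝓝 0) :=
    (tendsto_pow_atTop (by have := h.one_le_n; omega)).const_div_atTop C
  refine squeeze_zero' (Eventually.of_forall fun r => sizeSq_nonneg u q r) ?_ h1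
  filter_upwards [eventually_ge_atTop 1] with r hr
  have h0 : 0 < r := by linarith
  rw [le_div_iff₀ (by positivity), mul_comm]
  exact hb r hr

theorem tendsto_u (h : IsCoerciveProfile lam s lamInf sInf n α M k u q) :
    Tendsto u atTop (𝓝 0) := by
  rw [tendsto_zero_iff_abs_tendsto_zero]
  have h1 := h.tendsto_sizeSq.sqrt
  rw [Real.sqrt_zero] at h1
  refine squeeze_zero (fun r => abs_nonneg _) (fun r => ?_) h1
  exact Real.abs_le_sqrt (le_add_of_nonneg_right (sq_nonneg _))

/-- The profile vanishes at arbitrarily large radii. -/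
theorem exists_zero (h : IsCoerciveProfile lam s lamInf sInf n α M k u q) (R : ℝ) :
    ∃ r, R ≤ r ∧ u r = 0 := by
  by_contra! hne
  have hk := h.k_pos
  -- Without zeros the angle `arctan (u' / u)` is differentiable beyond `R₁` and falls at rate at
  -- least `k / 2`.
  set R₁ := max R (((n : ℝ) + 1) / k) with hR₁
  have hd : ∀ r, R₁ ≤ r → HasDerivAt (fun r => Real.arctan (r * q r / u r) + k / 2 * r)
      (1 / (1 + (r * q r / u r) ^ 2) * (((-radialNonlin lam s r (u r) - n * q r) * u r -
        (r * q r) * (r * q r)) / u r ^ 2) + k / 2) r := by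
    intro r hr
    have hu := hne r ((le_max_left _ _).trans hr)
    refine (((h.profile.hasDerivAt_mul_q r).div (h.profile.hasDerivAt_u r) hu).arctan.add
      ((hasDerivAt_id r).const_mul (k / 2))).congr_deriv ?_
    simp
  have ha : AntitoneOn (fun r => Real.arctan (r * q r / u r) + k / 2 * r) (Ici R₁) := by
    refine antitoneOn_of_deriv_nonpos (convex_Ici R₁)
      (fun r hr => (hd r hr).continuousAt.continuousWithinAt)
      (fun r hr => (hd r (interior_subset hr)).differentiableAt.differentiableWithinAt)
      fun r hr => ?_
    have hr' : R₁ ≤ r := interior_subset hr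
    have hrk : ((n : ℝ) + 1) / k ≤ r := (le_max_right _ _).trans hr'
    have h0 : 0 < r := h.radius_pos.trans_le hrk
    have hu := hne r ((le_max_left _ _).trans hr')
    rw [(hd r hr').deriv, radialNonlin_of_nonneg h0.le]
    have hu2 : 0 < u r ^ 2 := by positivity
    have hP : 0 < sizeSq u q r := by unfold sizeSq; positivity
    have e : 1 / (1 + (r * q r / u r) ^ 2) *
        (((-satNonlin (lam r) (s r) (u r) - n * q r) * u r - (r * q r) * (r * q r)) / u r ^ 2) =
        -(satNonlin (lam r) (s r) (u r) * u r + n * (u r * q r) + (r * q r) ^ 2) /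
          sizeSq u q r := by
      unfold sizeSq at *
      field_simp
      ring
    have h1 := h.k_mul_le h0.le
    have h2 := h.mul_abs_le_sizeSq hrk
    have h3 : -((n + 1) * |u r * q r|) ≤ n * (u r * q r) := by
      have := neg_abs_le (u r * q r)
      have h5 : n * (-|u r * q r|) ≤ n * (u r * q r) := by gcongr
      linarith [abs_nonneg (u r * q r)]
    have h4 := mul_le_mul_of_nonneg_right h.k_le_one (sq_nonneg (r * q r))
    rw [e, neg_div, neg_add_nonpos_iff, le_div_iff₀ hP]
    unfold sizeSq at *
    linarith
  -- Over a length `2π / k` the angle would fall by at least `π`, the full width of the open range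
  -- of `arctan`.
  set r := R₁ + 2 * Real.pi / k with hr
  have hle : R₁ ≤ r := by
    have : 0 ≤ 2 * Real.pi / k := by positivity
    linarith
  have h1 := ha (mem_Ici.2 le_rfl) (mem_Ici.2 hle) hle
  have h2 := Real.neg_pi_div_two_lt_arctan (r * q r / u r)
  have h3 := Real.arctan_lt_pi_div_two (R₁ * q R₁ / u R₁)
  have h4 : k / 2 * r = k / 2 * R₁ + Real.pi := by
    rw [hr]; field_simp
  simp only at h1
  linarith

end IsCoerciveProfile

end SaturableHelmholtz

/-! ### Part: the interval of initial values and continuity of the family in `C²`. -/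

namespace SaturableHelmholtz

variable {lam s : ℝ → ℝ} {lamInf sInf : ℝ} {n : ℕ}

/-- Initial values whose energy stays strictly below that of a confining height. -/
def initialValues (lam s : ℝ → ℝ) (lamInf sInf : ℝ) : Set ℝ :=
  {α | ∃ M, |α| < M ∧ lamInf * (sInf + M ^ 2) < 1 ∧
    satPrim (lam 0) (s 0) α < satPrim lamInf sInf M}

theorem confines_of_lt {α M : ℝ} (h1 : |α| < M) (h2 : lamInf * (sInf + M ^ 2) < 1)
    (h3 : satPrim (lam 0) (s 0) α < satPrim lamInf sInf M) : Confines lam s lamInf sInf α M :=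
  ⟨(abs_nonneg α).trans_lt h1, h1.le, h2, h3.le⟩

namespace Coefficients

theorem eventually_lt (h : Coefficients lam s lamInf sInf) {α M : ℝ} (h1 : |α| < M)
    (h3 : satPrim (lam 0) (s 0) α < satPrim lamInf sInf M) :
    ∀ᶠ β in 𝓝 α, |β| < M ∧ satPrim (lam 0) (s 0) β < satPrim lamInf sInf M :=
  (continuous_abs.continuousAt.eventually_lt continuousAt_const h1).and
    ((hasDerivAt_satPrim h.s_zero_pos α).continuousAt.eventually_lt continuousAt_const h3)

theorem isOpen_initialValues (h : Coefficients lam s lamInf sInf) :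
    IsOpen (initialValues lam s lamInf sInf) := by
  rw [isOpen_iff_mem_nhds]
  rintro α ⟨M, h1, h2, h3⟩
  filter_upwards [h.eventually_lt h1 h3] with β hβ
  exact ⟨M, hβ.1, h2, hβ.2⟩

/-- The height `M` for `α` also serves `β`, because `G(0, ·)` is even and increasing on `[0, M]`:
the inequality on `M` passes from the limits to `lam 0` and `s 0`. Hence the set is an interval. -/
theorem mem_initialValues_of_abs_le (h : Coefficients lam s lamInf sInf) {α β : ℝ}
    (hα : α ∈ initialValues lam s lamInf sInf) (hβ : |β| ≤ |α|) :
    β ∈ initialValues lam s lamInf sInf := by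
  obtain ⟨M, h1, h2, h3⟩ := hα
  refine ⟨M, hβ.trans_lt h1, h2, lt_of_le_of_lt ?_ h3⟩
  have h4 : lam 0 * (s 0 + M ^ 2) < 1 := by
    have hl := h.lam_le le_rfl
    have hs := h.s_le le_rfl
    have hs0 := h.s_zero_pos
    have hM : 0 < s 0 + M ^ 2 := by positivity
    rcases le_or_gt (lam 0) 0 with h5 | h5
    · nlinarith
    · refine lt_of_le_of_lt ?_ h2
      gcongr
      exact h5.le.trans hl
  have := (satPrim_strictMonoOn h.s_zero_pos h4).monotoneOn ⟨abs_nonneg β, (hβ.trans_lt h1).le⟩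
    ⟨abs_nonneg α, h1.le⟩ hβ
  rwa [satPrim_abs h.s_zero_pos, satPrim_abs h.s_zero_pos] at this

theorem ordConnected_initialValues (h : Coefficients lam s lamInf sInf) :
    (initialValues lam s lamInf sInf).OrdConnected := by
  refine ⟨fun x hx y hy z hz => ?_⟩
  rcases abs_le_max_abs_abs hz.1 hz.2 |> le_max_iff.1 with h1 | h1
  · exact h.mem_initialValues_of_abs_le hx h1
  · exact h.mem_initialValues_of_abs_le hy h1

theorem zero_mem_initialValues (h : Coefficients lam s lamInf sInf) :
    (0 : ℝ) ∈ initialValues lam s lamInf sInf := by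
  have h0 : lamInf * (sInf + 0 ^ 2) < 1 := by
    have := h.lamInf_lt
    rw [lt_div_iff₀ h.sInf_pos] at this
    simpa using this
  obtain ⟨M, hM, hlt⟩ := exists_gt_mul_lt h0
  have hM0 : 0 < M := hM
  refine ⟨M, by simpa using hM0, hlt, ?_⟩
  have := satPrim_strictMonoOn h.sInf_pos hlt ⟨le_rfl, hM0.le⟩ ⟨hM0.le, le_rfl⟩ hM0
  rwa [satPrim_zero] at this ⊢

theorem initialValues_eq_univ (h : Coefficients lam s lamInf sInf) (hl : lamInf ≤ 0) :
    initialValues lam s lamInf sInf = univ := by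
  refine eq_univ_of_forall fun α => ?_
  have hs := h.sInf_pos
  set c := satPrim (lam 0) (s 0) α
  -- The logarithm in `G_∞` is unbounded and `-lamInf * M²` does not hurt, so `G_∞(M)` can exceed
  -- any `c`; the square root ensures `log (1 + M² / sInf) > 2 c`.
  set M := |α| + 1 + √(sInf * Real.exp (2 * c)) with hM
  have h1 : |α| < M := by
    have := Real.sqrt_nonneg (sInf * Real.exp (2 * c))
    linarith
  have h0 : 0 < M := (abs_nonneg α).trans_lt h1
  refine ⟨M, h1, ?_, ?_⟩
  · have : 0 < sInf + M ^ 2 := by positivity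
    nlinarith
  · have h2 : sInf * Real.exp (2 * c) ≤ M ^ 2 := by
      rw [← Real.sqrt_le_left h0.le]
      linarith [abs_nonneg α]
    have h3 : 2 * c < Real.log (1 + M ^ 2 / sInf) := by
      rw [Real.lt_log_iff_exp_lt (by positivity)]
      have : Real.exp (2 * c) ≤ M ^ 2 / sInf := by
        rw [le_div_iff₀ hs]; linarith
      linarith
    rw [satPrim_eq hs]
    have : 0 ≤ -lamInf * M ^ 2 / 2 := by
      have : 0 ≤ -lamInf := by linarith
      positivity
    linarith

end Coefficients

theorem isCoerciveProfile (h : Coefficients lam s lamInf sInf) (hn : 1 ≤ n) {α M : ℝ}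
    {u q : ℝ → ℝ} (hp : IsRadialProfile n (radialNonlin lam s) α u q)
    (hM : Confines lam s lamInf sInf α M) :
    IsCoerciveProfile lam s lamInf sInf n α M (min 1 (1 / (sInf + M ^ 2) - lamInf)) u q :=
  ⟨h, hp, hM, hn, lt_min one_pos (h.kappa_pos hM.mul_lt), min_le_left _ _, min_le_right _ _⟩

theorem IsCoerciveProfile.sizeSq_le_of_energy_le {α M k R η r : ℝ} {u q : ℝ → ℝ}
    (h : IsCoerciveProfile lam s lamInf sInf n α M k u q) (hR : 0 ≤ R)
    (hE : energy lam s u q R ≤ k / 2 * η) (hr : R ≤ r) : sizeSq u q r ≤ η := by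
  have h1 := h.k_sizeSq_le_energy (hR.trans hr)
  have h2 := antitoneOn_energy h.coeff h.profile (mem_Ici.2 hR) (mem_Ici.2 (hR.trans hr)) hr
  have hk := h.k_pos
  exact le_of_mul_le_mul_left (h1.trans (h2.trans hE)) (by positivity)

theorem abs_sub_le_of_sizeSq_le {u q v w : ℝ → ℝ} {ε r : ℝ} (hε : 0 ≤ ε) (hr : 1 ≤ r)
    (h1 : sizeSq u q r ≤ (ε / 2) ^ 2) (h2 : sizeSq v w r ≤ (ε / 2) ^ 2) :
    |u r - v r| ≤ ε ∧ |r * (q r - w r)| ≤ ε ∧ |q r - w r| ≤ ε := by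
  unfold sizeSq at h1 h2
  have hε2 : 0 ≤ ε / 2 := by positivity
  have a1 : |u r| ≤ ε / 2 := abs_le_of_sq_le_sq (by nlinarith [sq_nonneg (r * q r)]) hε2
  have a2 : |v r| ≤ ε / 2 := abs_le_of_sq_le_sq (by nlinarith [sq_nonneg (r * w r)]) hε2
  have a3 : |r * q r| ≤ ε / 2 := abs_le_of_sq_le_sq (by nlinarith [sq_nonneg (u r)]) hε2
  have a4 : |r * w r| ≤ ε / 2 := abs_le_of_sq_le_sq (by nlinarith [sq_nonneg (v r)]) hε2
  have a5 : |r * (q r - w r)| ≤ ε := by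
    rw [mul_sub]
    exact (abs_sub _ _).trans (by linarith)
  refine ⟨(abs_sub _ _).trans (by linarith), a5, le_trans ?_ a5⟩
  rw [abs_mul, abs_of_pos (by linarith : 0 < r)]
  exact le_mul_of_one_le_left (abs_nonneg _) hr

theorem continuous_of_abs_sub_le {f : ℝ → ℝ} {C : ℝ} (h : ∀ α β, |f α - f β| ≤ C * |α - β|) :
    Continuous f :=
  (LipschitzWith.of_dist_le_mul (K := C.toNNReal) fun α β => by
    rw [Real.dist_eq, Real.dist_eq]
    refine (h α β).trans ?_
    gcongr
    exact Real.le_coe_toNNReal C).continuous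

/-- Solutions depend continuously on the initial value, uniformly in the radius. -/
theorem eventually_profile_close (h : Coefficients lam s lamInf sInf) (hn : 1 ≤ n)
    {u q : ℝ → ℝ → ℝ} {K : ℝ} (hK : 0 < K)
    (hp : ∀ α, IsRadialProfile n (radialNonlin lam s) α (u α) (q α))
    (hu : ∀ α β r, |u α r - u β r| ≤ 2 * |α - β| * Real.exp (K * r ^ 2))
    (hq : ∀ α β r, |q α r - q β r| ≤ K * (2 * |α - β|) * Real.exp (K * r ^ 2))
    {α : ℝ} (hα : α ∈ initialValues lam s lamInf sInf) {ε : ℝ} (hε : 0 < ε) :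
    ∀ᶠ β in 𝓝 α, ∀ r, 0 ≤ r → |u α r - u β r| ≤ ε ∧ |r * (q α r - q β r)| ≤ ε ∧
      |q α r - q β r| ≤ ε := by
  obtain ⟨M, h1, h2, h3⟩ := hα
  have hcα := isCoerciveProfile h hn (hp α) (confines_of_lt h1 h2 h3)
  set k := min 1 (1 / (sInf + M ^ 2) - lamInf)
  have hk : 0 < k := hcα.k_pos
  have hlip := h.lipBound_pos
  -- At `R` the energy of the `α`-profile is strictly below a threshold. By continuity at this one
  -- radius the same holds for nearby `β`, and monotonicity of the energy then controls both tails
  -- on `[R, ∞)`.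
  obtain ⟨R, hR1, hRs⟩ : ∃ R, 1 ≤ R ∧ energy lam s (u α) (q α) R < k / 2 * (ε / 2) ^ 2 := by
    have ht := hcα.tendsto_sizeSq.const_mul ((1 + lipBound lam s lamInf) / 2)
    rw [mul_zero] at ht
    obtain ⟨R, hR, hR1⟩ := ((ht.eventually_lt_const (show 0 < k / 2 * (ε / 2) ^ 2 by positivity)).and
      (eventually_ge_atTop 1)).exists
    exact ⟨R, hR1, (hcα.energy_le_sizeSq (by linarith)).trans_lt hR⟩
  have hR0 : 0 < R := by linarith
  have hcu : Continuous fun β => u β R := continuous_of_abs_sub_le fun a b => by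
    refine (hu a b R).trans_eq ?_
    rw [mul_right_comm]
  have hcq : Continuous fun β => q β R := continuous_of_abs_sub_le fun a b => by
    refine (hq a b R).trans_eq ?_
    rw [← mul_assoc, mul_right_comm]
  have hcE : Continuous fun β => energy lam s (u β) (q β) R := by
    have hG : Continuous (satPrim (lam R) (s R)) := continuous_iff_continuousAt.2 fun z =>
      (hasDerivAt_satPrim (h.s_pos R hR0.le) z).continuousAt
    unfold energy
    fun_prop
  have hE := hcE.continuousAt.eventually_lt continuousAt_const hRs
  -- The factors `1 + R` and `1 + K` cover the three differences `u`, `r q` and `q` on `[0, R]` at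
  -- once.
  have hsmall : ∀ᶠ β in 𝓝 α, (1 + R) * (1 + K) * (2 * |α - β|) * Real.exp (K * R ^ 2) < ε := by
    have hc : Continuous fun β : ℝ => (1 + R) * (1 + K) * (2 * |α - β|) * Real.exp (K * R ^ 2) := by
      fun_prop
    exact hc.continuousAt.eventually_lt continuousAt_const (by simpa using hε)
  filter_upwards [hE, hsmall, h.eventually_lt h1 h3] with β hEβ hβ hMβ r hr
  rcases le_total R r with hle | hle
  · have hcβ := isCoerciveProfile h hn (hp β) (confines_of_lt hMβ.1 h2 hMβ.2)
    exact abs_sub_le_of_sizeSq_le hε.le (hR1.trans hle)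
      (hcα.sizeSq_le_of_energy_le hR0.le hRs.le hle) (hcβ.sizeSq_le_of_energy_le hR0.le hEβ.le hle)
  · have hexp : Real.exp (K * r ^ 2) ≤ Real.exp (K * R ^ 2) := by gcongr
    set X := 2 * |α - β| * Real.exp (K * R ^ 2) with hX
    have hX0 : 0 ≤ X := by positivity
    have hXε : (1 + R) * (1 + K) * X ≤ ε := by
      rw [hX]; linarith
    have a1 : |u α r - u β r| ≤ X := (hu α β r).trans (by rw [hX]; gcongr)
    have a2 : |q α r - q β r| ≤ K * X := by
      rw [hX, ← mul_assoc]
      exact (hq α β r).trans (mul_le_mul_of_nonneg_left hexp (by positivity))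
    have a3 : |r * (q α r - q β r)| ≤ R * (K * X) := by
      rw [abs_mul, abs_of_nonneg hr]
      gcongr
    have b1 : 0 ≤ R * X := by positivity
    have b2 : 0 ≤ K * X := by positivity
    have b3 : 0 ≤ R * (K * X) := by positivity
    refine ⟨?_, ?_, ?_⟩ <;> linarith

/-- The radial function on `ℝ^(n+1)` with a given profile, as an element of `C²`. -/
noncomputable def radialC2 (h : Coefficients lam s lamInf sInf) {α : ℝ} {u q : ℝ → ℝ}
    (hp : IsRadialProfile n (radialNonlin lam s) α u q) : C2Space (n + 1) :=
  ⟨fun x => u ‖x‖, hp.contDiff_comp_norm h.continuous_radialNonlin⟩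

set_option maxSynthPendingDepth 3 in
theorem continuousOn_radialC2 (h : Coefficients lam s lamInf sInf) (hn : 1 ≤ n)
    {u q : ℝ → ℝ → ℝ} {K : ℝ} (hK : 0 < K)
    (hp : ∀ α, IsRadialProfile n (radialNonlin lam s) α (u α) (q α))
    (hu : ∀ α β r, |u α r - u β r| ≤ 2 * |α - β| * Real.exp (K * r ^ 2))
    (hq : ∀ α β r, |q α r - q β r| ≤ K * (2 * |α - β|) * Real.exp (K * r ^ 2)) :
    ContinuousOn (fun α => radialC2 h (hp α)) (initialValues lam s lamInf sInf) := by
  intro α hα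
  apply ContinuousAt.continuousWithinAt
  rw [(Topology.IsInducing.mk rfl : Topology.IsInducing (fun u : C2Space (n + 1) =>
      (UniformFun.ofFun u.1, UniformFun.ofFun (fderiv ℝ u.1),
        UniformFun.ofFun (fderiv ℝ (fderiv ℝ u.1))))).continuousAt_iff]
  have key := fun {ε : ℝ} (hε : 0 < ε) => eventually_profile_close h hn hK hp hu hq hα hε
  have hlip := h.lipBound_pos
  refine ContinuousAt.prodMk ?_ (ContinuousAt.prodMk ?_ ?_)
  · refine UniformFun.tendsto_iff_tendstoUniformly.2 (Metric.tendstoUniformly_iff.2 fun ε hε => ?_)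
    filter_upwards [key (half_pos hε)] with β hβ x
    have := (hβ ‖x‖ (norm_nonneg x)).1
    exact (show |u α ‖x‖ - u β ‖x‖| < ε by linarith)
  · refine UniformFun.tendsto_iff_tendstoUniformly.2 (Metric.tendstoUniformly_iff.2 fun ε hε => ?_)
    filter_upwards [key (half_pos hε)] with β hβ x
    have := (hβ ‖x‖ (norm_nonneg x)).2.1
    change dist (fderiv ℝ (fun x : EuclideanSpace ℝ (Fin (n + 1)) => u α ‖x‖) x)
      (fderiv ℝ (fun x : EuclideanSpace ℝ (Fin (n + 1)) => u β ‖x‖) x) < ε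
    rw [(hp α).fderiv_eq, (hp β).fderiv_eq, dist_eq_norm, ← sub_smul, norm_smul,
      norm_innerBilin_apply, Real.norm_eq_abs, mul_comm]
    rw [abs_mul, abs_norm] at this
    linarith
  · refine UniformFun.tendsto_iff_tendstoUniformly.2 (Metric.tendstoUniformly_iff.2 fun ε hε => ?_)
    -- The Hessian difference is at most `n + 2 + lipBound` times the profile error; one more unit
    -- gives strict inequality.
    set c : ℝ := 3 + n + lipBound lam s lamInf with hc
    have hc0 : 0 < c := by positivity
    filter_upwards [key (div_pos hε hc0)] with β hβ x
    obtain ⟨b1, -, b2⟩ := hβ ‖x‖ (norm_nonneg x)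
    change dist (fderiv ℝ (fderiv ℝ (fun x : EuclideanSpace ℝ (Fin (n + 1)) => u α ‖x‖)) x)
      (fderiv ℝ (fderiv ℝ (fun x : EuclideanSpace ℝ (Fin (n + 1)) => u β ‖x‖)) x) < ε
    rw [(hp α).fderiv_fderiv_eq, (hp β).fderiv_fderiv_eq, dist_eq_norm, radialHessian_sub]
    refine (norm_radialHessian_le _ _ x).trans_lt ?_
    have b3 : |radialNonlin lam s ‖x‖ (u α ‖x‖) - radialNonlin lam s ‖x‖ (u β ‖x‖)| ≤
        lipBound lam s lamInf * |u α ‖x‖ - u β ‖x‖| :=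
      h.abs_satNonlin_sub_le (abs_nonneg _) _ _
    have b4 : |IsRadialProfile.anisotropy n (radialNonlin lam s) (u α) (q α) ‖x‖ -
        IsRadialProfile.anisotropy n (radialNonlin lam s) (u β) (q β) ‖x‖| ≤
        lipBound lam s lamInf * |u α ‖x‖ - u β ‖x‖| + (n + 1) * |q α ‖x‖ - q β ‖x‖| := by
      have e : IsRadialProfile.anisotropy n (radialNonlin lam s) (u α) (q α) ‖x‖ -
          IsRadialProfile.anisotropy n (radialNonlin lam s) (u β) (q β) ‖x‖ =
          -(radialNonlin lam s ‖x‖ (u α ‖x‖) - radialNonlin lam s ‖x‖ (u β ‖x‖)) -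
            (n + 1) * (q α ‖x‖ - q β ‖x‖) := by
        unfold IsRadialProfile.anisotropy; ring
      rw [e]
      refine (abs_sub _ _).trans (add_le_add (by rwa [abs_neg]) ?_)
      rw [abs_mul, abs_of_nonneg (by positivity : (0 : ℝ) ≤ n + 1)]
    have hδ : 0 < ε / c := div_pos hε hc0
    have hsum : c * (ε / c) = ε := mul_div_cancel₀ _ hc0.ne'
    have b5 := mul_le_mul_of_nonneg_left b1 hlip.le
    have b6 := mul_le_mul_of_nonneg_left b2 (by positivity : (0 : ℝ) ≤ n + 1)
    rw [← hsum, hc]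
    linarith

theorem isClassicalSolution_radialC2 (h : Coefficients lam s lamInf sInf) {α : ℝ} {u q : ℝ → ℝ}
    (hp : IsRadialProfile n (radialNonlin lam s) α u q) :
    IsClassicalSolution lam s (radialC2 h hp) := by
  intro x
  change -(Laplacian.laplacian (fun x : EuclideanSpace ℝ (Fin (n + 1)) => u ‖x‖) x) +
    lam ‖x‖ * u ‖x‖ = u ‖x‖ / (s ‖x‖ + u ‖x‖ ^ 2)
  rw [hp.laplacian_eq, radialNonlin_of_nonneg (norm_nonneg x), satNonlin]
  ring

namespace IsCoerciveProfile

variable {α M k : ℝ} {u q : ℝ → ℝ}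

theorem isOscillating (h : IsCoerciveProfile lam s lamInf sInf n α M k u q) :
    IsOscillating fun x : EuclideanSpace ℝ (Fin (n + 1)) => u ‖x‖ := by
  choose r hr hur using fun m : ℕ => h.exists_zero m
  have hnorm : ∀ m, ‖EuclideanSpace.single (0 : Fin (n + 1)) (r m)‖ = r m := fun m => by
    rw [PiLp.norm_single, Real.norm_eq_abs,
      abs_of_nonneg ((Nat.cast_nonneg m).trans (hr m))]
  refine ⟨fun m => EuclideanSpace.single 0 (r m), ?_, fun m => ?_⟩
  · simp only [hnorm]
    exact tendsto_atTop_mono hr tendsto_natCast_atTop_atTop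
  · simp only [hnorm, hur]

theorem isLocalized (h : IsCoerciveProfile lam s lamInf sInf n α M k u q) :
    IsLocalized fun x : EuclideanSpace ℝ (Fin (n + 1)) => u ‖x‖ :=
  h.tendsto_u.comp tendsto_norm_cocompact_atTop

end IsCoerciveProfile

end SaturableHelmholtz

/-! ### Part: assembly of the result. -/

theorem corollary2p9 (N : ℕ) (hN : 2 ≤ N) (lam s : ℝ → ℝ) (lamInf sInf : ℝ)
    (hlam : ContDiffOn ℝ 1 lam (Set.Ici 0)) (hs : ContDiffOn ℝ 1 s (Set.Ici 0))
    (hlam_mono : MonotoneOn lam (Set.Ici 0)) (hs_mono : MonotoneOn s (Set.Ici 0))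
    (hlam_lim : Filter.Tendsto lam Filter.atTop (nhds lamInf))
    (hs_lim : Filter.Tendsto s Filter.atTop (nhds sInf))
    (hs_pos : ∀ r : ℝ, 0 ≤ r → 0 < s r)
    (hlt : lamInf < 1 / sInf) :
    ∃ (I : Set ℝ) (u : ℝ → SaturableHelmholtz.C2Space N),
      IsOpen I ∧ I.OrdConnected ∧ (0 : ℝ) ∈ I ∧
      (lamInf ≤ 0 → I = Set.univ) ∧
      -- the set of the `u α`, `α ∈ I`, is a continuum in `C²(ℝ^N)`
      IsConnected (u '' I) ∧
      ∀ α ∈ I,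
        SaturableHelmholtz.IsClassicalSolution lam s (u α) ∧
        SaturableHelmholtz.IsOscillating (u α) ∧
        SaturableHelmholtz.IsLocalized (u α) ∧
        u α 0 = α ∧
        -- `φ` is the radial profile of `u α`, extended to an even function on `ℝ`
        ∃ φ : ℝ → ℝ, ContDiff ℝ 2 φ ∧ Function.Even φ ∧ (∀ x, u α x = φ ‖x‖) ∧
          (∃ a b : ℝ, SaturableHelmholtz.IsAdmissible lam s lamInf sInf α a b) ∧
          (∀ a b : ℝ, SaturableHelmholtz.IsAdmissible lam s lamInf sInf α a b →
            ∀ r : ℝ, |φ r| ≤ min a b) ∧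
          (∀ r : ℝ, |deriv φ r| ≤ Real.sqrt (2 * SaturableHelmholtz.satPrim (lam 0) (s 0) α)) ∧
          (∃ C : ℝ, 0 < C ∧ ∀ r : ℝ, 1 ≤ r →
            |φ r| + |deriv φ r| + |deriv (deriv φ) r| ≤ C * r ^ ((1 - (N : ℝ)) / 2)) ∧
          (α ≠ 0 → ∃ c : ℝ, 0 < c ∧ ∀ r : ℝ, 1 ≤ r →
            c * r ^ ((1 - (N : ℝ)) / 2) ≤ |φ r| + |deriv φ r| + |deriv (deriv φ) r|) := by

  obtain ⟨n, rfl⟩ : ∃ n, N = n + 1 := ⟨N - 1, by omega⟩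
  have hn : 1 ≤ n := by omega
  have h : SaturableHelmholtz.Coefficients lam s lamInf sInf :=
    ⟨hlam, hs, hlam_mono, hs_mono, hlam_lim, hs_lim, hs_pos, hlt⟩
  obtain ⟨u, q, hp, hu, hq⟩ := h.exists_family n
  refine ⟨SaturableHelmholtz.initialValues lam s lamInf sInf,
    fun α => SaturableHelmholtz.radialC2 h (hp α), h.isOpen_initialValues,
    h.ordConnected_initialValues, h.zero_mem_initialValues, h.initialValues_eq_univ, ?_, ?_⟩
  · have hI : IsConnected (SaturableHelmholtz.initialValues lam s lamInf sInf) :=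
      ⟨⟨0, h.zero_mem_initialValues⟩, h.ordConnected_initialValues.isPreconnected⟩
    exact hI.image _ (SaturableHelmholtz.continuousOn_radialC2 h hn h.lipBound_pos hp hu hq)
  -- The height `M` from membership in `I` yields decay, oscillation and an admissible pair; the sup
  -- bound for an arbitrary admissible pair uses its own confining height `min a b`.
  · rintro α ⟨M, h1, h2, h3⟩
    have hM := SaturableHelmholtz.confines_of_lt h1 h2 h3
    have hc := SaturableHelmholtz.isCoerciveProfile h hn (hp α) hM
    refine ⟨SaturableHelmholtz.isClassicalSolution_radialC2 h (hp α), hc.isOscillating,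
      hc.isLocalized, ?_, u α, (hp α).contDiff h.continuous_radialNonlin, (hp α).even_u,
      fun _ => rfl, ⟨M, M, hM.isAdmissible h⟩, fun a b hab =>
        SaturableHelmholtz.Confines.abs_le h (hp α) (hab.confines h), ?_, hc.exists_decay,
      hc.exists_lower_decay⟩
    · change u α ‖(0 : EuclideanSpace ℝ (Fin (n + 1)))‖ = α
      rw [norm_zero, (hp α).u_zero]
    · rw [(hp α).deriv_u]
      exact SaturableHelmholtz.abs_mul_q_le h (hp α) hM
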